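/- Let $d \ge 3$ and let $\mathcal P$ be a homogeneous Poisson point process on $\mathbb R^d$ of intensity $\rho > 0$. For $x \in \mathbb R^d$ let $$F_{\mathcal P}(x) = \lim_{R \to \infty} \sum_{z \in (\mathcal P \setminus \{x\}) \cap B(x,R)} \frac{x - z}{\|x - z\|_2^d},$$ where $B(x,R)$ is the ball of centre $x$ and radius $R$. Put $\alpha = \frac{d}{d-1}$. Then, for every $x \in \mathbb R^d$, the limit exists almost surely, and the random vector $F_{\mathcal P}(x)$ has a symmetric $\alpha$-stable distribution: $F_{\mathcal P}(x)$ and $-F_{\mathcal P}(x)$ have the same law, this law is not a point mass, and, if $Y_1, Y_2, Y$ have this law with $Y_1, Y_2$ independent, then for all $a, b > 0$ there is a deterministic vector $v\in\mathbb R^d$ such that $aY_1 + bY_2$ and $(a^\alpha + b^\alpha)^{1/\alpha}\, Y + v$ have the same law. Moreover, $F_{\mathcal P}(x)$ is integrable with $\mathbb E[F_{\mathcal P}(x)] = 0$, and for every real $\nu \ge 0$ one has $\mathbb E\big[\|F_{\mathcal P}(x)\|_2^{\nu}\big] < \infty$ if and only if $\nu < \alpha$. -/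

import Mathlib

open MeasureTheory ProbabilityTheory Filter Topology
open scoped NNReal ENNReal

/-- A configuration of `ℝ^d`: a locally finite set of points. -/
structure Configuration (d : ℕ) where
  /-- the underlying set of points -/
  points : Set (EuclideanSpace ℝ (Fin d))
  /-- every bounded set contains only finitely many of the points -/
  locallyFinite : ∀ B : Set (EuclideanSpace ℝ (Fin d)),
    Bornology.IsBounded B → (points ∩ B).Finite

namespace Configuration

variable {d : ℕ}

/-- The number of points of the configuration in `B` (used for bounded `B`, where it is the true
cardinality of a finite set). -/
noncomputable def count (B : Set (EuclideanSpace ℝ (Fin d))) (X : Configuration d) : ℕ :=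
  (X.points ∩ B).ncard

/-- The σ-algebra on configurations generated by the counts `X ↦ X(B)`, `B` bounded Borel. -/
noncomputable instance instMeasurableSpace : MeasurableSpace (Configuration d) :=
  ⨆ (B : Set (EuclideanSpace ℝ (Fin d))) (_ : MeasurableSet B) (_ : Bornology.IsBounded B),
    MeasurableSpace.comap (count B) ⊤

/-- The force at `x` exerted by the finitely many points of `X \ {x}` in the ball `B(x, R)`:
the sum of `(x - z) / ‖x - z‖ ^ d`. -/
noncomputable def truncatedForce (X : Configuration d) (x : EuclideanSpace ℝ (Fin d)) (R : ℝ) :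
    EuclideanSpace ℝ (Fin d) :=
  ∑ᶠ z ∈ (X.points \ {x}) ∩ Metric.ball x R, (‖x - z‖ ^ d)⁻¹ • (x - z)

/-- The series defining the force at `x`, summed over increasing balls centred at `x`,
converges. -/
def ForceConverges (X : Configuration d) (x : EuclideanSpace ℝ (Fin d)) : Prop :=
  ∃ l : EuclideanSpace ℝ (Fin d), Tendsto (X.truncatedForce x) atTop (𝓝 l)

/-- The Coulomb force `F_X(x)`: the limit of the truncated forces as `R → ∞`
(an arbitrary value if the limit does not exist). -/
noncomputable def force (X : Configuration d) (x : EuclideanSpace ℝ (Fin d)) :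
    EuclideanSpace ℝ (Fin d) :=
  limUnder atTop (X.truncatedForce x)

end Configuration

/-- The random configuration `P` is a homogeneous Poisson point process of intensity `ρ` on `ℝ^d`:
it is a random element of the space of configurations, the number of points in a bounded Borel set
`B` is Poisson with mean `ρ |B|`, and the numbers of points in finitely many pairwise disjoint
bounded Borel sets are independent. -/
structure IsHomogeneousPoissonProcess {d : ℕ} {Ω : Type*} [MeasurableSpace Ω]
    (P : Ω → Configuration d) (ρ : ℝ≥0) (μ : Measure Ω) : Prop where
  measurable : Measurable P
  hasLaw_count : ∀ B : Set (EuclideanSpace ℝ (Fin d)), MeasurableSet B → Bornology.IsBounded B →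
    HasLaw (fun ω => (P ω).count B) (poissonMeasure (ρ * (volume B).toNNReal)) μ
  indep_count : ∀ (n : ℕ) (B : Fin n → Set (EuclideanSpace ℝ (Fin d))),
    (∀ i, MeasurableSet (B i)) → (∀ i, Bornology.IsBounded (B i)) →
    Pairwise (fun i j => Disjoint (B i) (B j)) →
    iIndepFun (fun i ω => (P ω).count (B i)) μ

/-- The law `m` on `ℝ^d` is a (nondegenerate) `α`-stable distribution: `0 < α ≤ 2`, `m` is not a
point mass, and if `Y₁, Y₂, Y` have law `m` with `Y₁, Y₂` independent, then for all `a, b > 0` the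
vector `a Y₁ + b Y₂` has the law of `(a ^ α + b ^ α) ^ (1 / α) Y + v` for some deterministic
vector `v`. -/
structure IsStableDistribution {d : ℕ} (α : ℝ) (m : Measure (EuclideanSpace ℝ (Fin d))) :
    Prop where
  isProbabilityMeasure : IsProbabilityMeasure m
  index_pos : 0 < α
  index_le_two : α ≤ 2
  nondegenerate : ∀ v : EuclideanSpace ℝ (Fin d), m ≠ Measure.dirac v
  stable : ∀ a b : ℝ, 0 < a → 0 < b → ∃ v : EuclideanSpace ℝ (Fin d),
    (m.prod m).map (fun y => a • y.1 + b • y.2) =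
      m.map (fun y => ((a ^ α + b ^ α) ^ (1 / α)) • y + v)

/-- A symmetric `α`-stable distribution: an `α`-stable law that is invariant under `y ↦ -y`. -/
structure IsSymmetricStableDistribution {d : ℕ} (α : ℝ)
    (m : Measure (EuclideanSpace ℝ (Fin d))) : Prop extends IsStableDistribution α m where
  symmetric : m.map (fun y => -y) = m

/-! The law is found through its characteristic function. For a Poisson process, the expectation of
`exp (i ∑ g(z))` over a bounded set `B` is `exp (ρ ∫_B (e^{ig} - 1))` (`integral_cexp_sumOver`): a
simple `g` reduces to independent Poisson counts, and dominated convergence does the rest. With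
`K(y) = y / ‖y‖^d` and `g(z) = ⟨K(x - z), t⟩` on balls centred at `x`, the sine part cancels because
`K` is odd. Letting the radius grow gives `exp (-ρ ψ(t))` with `ψ(t) = ∫ (1 - cos ⟨K(y), t⟩) dy`
(`charFun_force`). This integral converges: its integrand is bounded near the origin and at most of
order `‖y‖^{-2(d-1)}` at infinity, where `2(d-1) > d`.

Since `K` is homogeneous of degree `-(d-1)`, a dilation of the variable gives `ψ(st) = s^α ψ(t)` for
`s > 0` (`coulombExponent_smul`). Evenness of `ψ` gives symmetry, and homogeneity gives stability
with zero shift. Moments below `α` come from a tail bound by the characteristic function. The moment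
of order `α` is infinite: otherwise dominated convergence would force `(1 - exp (-s^α ρψ(t))) / s^α
→ 0` as `s → 0`, although `ψ(t) > 0` for `t ≠ 0`.

Almost sure convergence is separate. Space outside the unit ball is cut into shells of equal volume
centred at `x`. Their contributions to `⟨F, t⟩` are independent and centred, and their partial sums
are bounded in `L²`, so martingale convergence applies along the shell radii. For radii in between,
the error is at most a shell count times `‖t‖` and the kernel size there, and it vanishes by a
second moment sum (`ae_tendsto_count_shell`). -/

/-! ### Finite sums over a configuration. -/

namespace Configuration

variable {d : ℕ}

/-- The sum of `g` over the points of the configuration that lie in `B`. -/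
noncomputable def sumOver (X : Configuration d) (B : Set (EuclideanSpace ℝ (Fin d)))
    (g : EuclideanSpace ℝ (Fin d) → ℝ) : ℝ :=
  ∑ᶠ z ∈ X.points ∩ B, g z

lemma sumOver_eq_sum (X : Configuration d) {B : Set (EuclideanSpace ℝ (Fin d))}
    (hB : Bornology.IsBounded B) (g : EuclideanSpace ℝ (Fin d) → ℝ) :
    X.sumOver B g = ∑ z ∈ (X.locallyFinite B hB).toFinset, g z :=
  finsum_mem_eq_finite_toFinset_sum _ _

lemma tendsto_sumOver (X : Configuration d) {B : Set (EuclideanSpace ℝ (Fin d))}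
    (hB : Bornology.IsBounded B) {g : EuclideanSpace ℝ (Fin d) → ℝ}
    {G : ℕ → EuclideanSpace ℝ (Fin d) → ℝ} (h : ∀ z, Tendsto (fun n => G n z) atTop (𝓝 (g z))) :
    Tendsto (fun n => X.sumOver B (G n)) atTop (𝓝 (X.sumOver B g)) := by
  simp only [sumOver_eq_sum X hB]
  exact tendsto_finsetSum _ fun z _ => h z

lemma sumOver_const_mul (X : Configuration d) {B : Set (EuclideanSpace ℝ (Fin d))}
    (hB : Bornology.IsBounded B) (a : ℝ) (g : EuclideanSpace ℝ (Fin d) → ℝ) :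
    X.sumOver B (fun z => a * g z) = a * X.sumOver B g := by
  simp only [sumOver_eq_sum X hB, Finset.mul_sum]

lemma sumOver_finset_sum (X : Configuration d) {B : Set (EuclideanSpace ℝ (Fin d))}
    (hB : Bornology.IsBounded B) {ι : Type*} (s : Finset ι)
    (g : ι → EuclideanSpace ℝ (Fin d) → ℝ) :
    X.sumOver B (fun z => ∑ i ∈ s, g i z) = ∑ i ∈ s, X.sumOver B (g i) := by
  simp only [sumOver_eq_sum X hB]
  exact Finset.sum_comm

lemma sumOver_indicator (X : Configuration d) {A B : Set (EuclideanSpace ℝ (Fin d))}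
    (hAB : A ⊆ B) (g : EuclideanSpace ℝ (Fin d) → ℝ) :
    X.sumOver B (A.indicator g) = X.sumOver A g := by
  unfold sumOver
  rw [finsum_mem_def, finsum_mem_def]
  congr 1
  ext z
  by_cases hz : z ∈ A
  · by_cases hp : z ∈ X.points
    · have hA : z ∈ X.points ∩ A := ⟨hp, hz⟩
      have hB : z ∈ X.points ∩ B := ⟨hp, hAB hz⟩
      rw [Set.indicator_of_mem hB, Set.indicator_of_mem hz, Set.indicator_of_mem hA]
    · have hA : z ∉ X.points ∩ A := fun h => hp h.1
      have hB : z ∉ X.points ∩ B := fun h => hp h.1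
      rw [Set.indicator_of_notMem hB, Set.indicator_of_notMem hA]
  · have hA : z ∉ X.points ∩ A := fun h => hz h.2
    rw [Set.indicator_of_notMem hA]
    simp [Set.indicator, hz]

lemma sumOver_union (X : Configuration d) {A B : Set (EuclideanSpace ℝ (Fin d))}
    (hA : Bornology.IsBounded A) (hB : Bornology.IsBounded B) (hAB : Disjoint A B)
    (g : EuclideanSpace ℝ (Fin d) → ℝ) :
    X.sumOver (A ∪ B) g = X.sumOver A g + X.sumOver B g := by
  unfold sumOver
  rw [Set.inter_union_distrib_left]
  exact finsum_mem_union (hAB.mono Set.inter_subset_right Set.inter_subset_right)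
    (X.locallyFinite A hA) (X.locallyFinite B hB)

lemma count_eq_card (X : Configuration d) {B : Set (EuclideanSpace ℝ (Fin d))}
    (hB : Bornology.IsBounded B) : X.count B = (X.locallyFinite B hB).toFinset.card :=
  Set.ncard_eq_toFinset_card _ _

/-- Grouping points by level set reduces sums to counts, the only quantities that the hypotheses on
the process control. -/
lemma sumOver_simpleFunc (X : Configuration d) {B : Set (EuclideanSpace ℝ (Fin d))}
    (hB : Bornology.IsBounded B) (s : SimpleFunc (EuclideanSpace ℝ (Fin d)) ℝ) :
    X.sumOver B s = ∑ c : s.range, (c : ℝ) * X.count (s ⁻¹' {(c : ℝ)} ∩ B) := by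
  classical
  rw [sumOver_eq_sum X hB, Finset.sum_coe_sort s.range
    (fun c => c * (X.count (s ⁻¹' {c} ∩ B) : ℝ)),
    ← Finset.sum_fiberwise_of_maps_to (t := s.range) (g := s) fun z _ => s.mem_range_self z]
  refine Finset.sum_congr rfl fun c _ => ?_
  rw [Finset.sum_congr rfl fun z hz => (Finset.mem_filter.1 hz).2, Finset.sum_const,
    nsmul_eq_mul, mul_comm, count_eq_card X (hB.subset Set.inter_subset_right)]
  congr 3
  ext z
  simp only [Finset.mem_filter, Set.Finite.mem_toFinset, Set.mem_inter_iff, Set.mem_preimage,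
    Set.mem_singleton_iff]
  tauto

lemma measurable_count {B : Set (EuclideanSpace ℝ (Fin d))} (hB : MeasurableSet B)
    (hb : Bornology.IsBounded B) : Measurable (count B : Configuration d → ℕ) := by
  rw [measurable_iff_comap_le]
  exact le_iSup_of_le B (le_iSup_of_le hB (le_iSup_of_le hb le_rfl))

lemma measurable_sumOver {B : Set (EuclideanSpace ℝ (Fin d))} (hB : MeasurableSet B)
    (hb : Bornology.IsBounded B) {g : EuclideanSpace ℝ (Fin d) → ℝ} (hg : Measurable g) :
    Measurable (fun X : Configuration d => X.sumOver B g) := by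
  refine measurable_of_tendsto_metrizable
    (f := fun n (X : Configuration d) => X.sumOver B (hg.stronglyMeasurable.approx n)) (fun n => ?_)
    (tendsto_pi_nhds.2 fun X => X.tendsto_sumOver hb hg.stronglyMeasurable.tendsto_approx)
  simp only [sumOver_simpleFunc _ hb]
  refine Finset.measurable_sum _ fun c _ => Measurable.const_mul ?_ _
  exact (measurable_from_top (f := fun n : ℕ => (n : ℝ))).comp
    (measurable_count ((hg.stronglyMeasurable.approx n).measurableSet_preimage _ |>.inter hB)
      (hb.subset Set.inter_subset_right))

end Configuration

/-! ### The characteristic functional and independence over disjoint sets. -/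

namespace IsHomogeneousPoissonProcess

variable {d : ℕ} {Ω : Type*} [MeasurableSpace Ω] {P : Ω → Configuration d} {ρ : ℝ≥0}
  {μ : Measure Ω}

lemma iIndepFun_count (hP : IsHomogeneousPoissonProcess P ρ μ) {ι : Type*} [Fintype ι]
    (B : ι → Set (EuclideanSpace ℝ (Fin d))) (hB : ∀ i, MeasurableSet (B i))
    (hb : ∀ i, Bornology.IsBounded (B i)) (hd : Pairwise fun i j => Disjoint (B i) (B j)) :
    iIndepFun (fun i ω => (P ω).count (B i)) μ := by
  let e := Fintype.equivFin ι
  have := (hP.indep_count (Fintype.card ι) (fun i => B (e.symm i)) (fun _ => hB _) (fun _ => hb _)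
    (fun i j hij => hd (e.symm.injective.ne hij))).precomp e.injective
  simpa [Function.comp_def] using this

lemma charFun_count (hP : IsHomogeneousPoissonProcess P ρ μ)
    {B : Set (EuclideanSpace ℝ (Fin d))} (hB : MeasurableSet B) (hb : Bornology.IsBounded B)
    (t : ℝ) : charFun (μ.map fun ω => ((P ω).count B : ℝ)) t =
      Complex.exp (ρ * volume.real B * (Complex.exp (t * Complex.I) - 1)) := by
  have h := (hP.hasLaw_count B hB hb)
  have h2 : μ.map (fun ω => ((P ω).count B : ℝ)) =
      (poissonMeasure (ρ * (volume B).toNNReal)).map (Nat.cast : ℕ → ℝ) := by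
    rw [← h.map_eq, AEMeasurable.map_map_of_aemeasurable .of_discrete h.aemeasurable]
    rfl
  rw [h2, charFun_map_cast_poissonMeasure]
  norm_cast

lemma measurable_sumOver (hP : IsHomogeneousPoissonProcess P ρ μ)
    {B : Set (EuclideanSpace ℝ (Fin d))} (hB : MeasurableSet B) (hb : Bornology.IsBounded B)
    {g : EuclideanSpace ℝ (Fin d) → ℝ} (hg : Measurable g) :
    Measurable (fun ω => (P ω).sumOver B g) :=
  (Configuration.measurable_sumOver hB hb hg).comp hP.measurable

/-- The level sets are disjoint, so the sum is a combination of independent Poisson variables and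
its characteristic function is a product of Poisson ones. -/
lemma integral_cexp_sumOver_simpleFunc [IsProbabilityMeasure μ]
    (hP : IsHomogeneousPoissonProcess P ρ μ)
    {B : Set (EuclideanSpace ℝ (Fin d))} (hB : MeasurableSet B) (hb : Bornology.IsBounded B)
    (s : SimpleFunc (EuclideanSpace ℝ (Fin d)) ℝ) :
    ∫ ω, Complex.exp ((P ω).sumOver B s * Complex.I) ∂μ =
      Complex.exp (ρ * ∫ z in B, (Complex.exp (s z * Complex.I) - 1)) := by
  have hm : ∀ c : s.range, MeasurableSet (s ⁻¹' {(c : ℝ)} ∩ B) :=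
    fun c => (s.measurableSet_preimage _).inter hB
  have hbd : ∀ c : s.range, Bornology.IsBounded (s ⁻¹' {(c : ℝ)} ∩ B) :=
    fun c => hb.subset Set.inter_subset_right
  have hmc : ∀ c : s.range, Measurable fun ω => ((P ω).count (s ⁻¹' {(c : ℝ)} ∩ B) : ℝ) :=
    fun c => (measurable_from_top (f := fun n : ℕ => (n : ℝ))).comp
      ((Configuration.measurable_count (hm c) (hbd c)).comp hP.measurable)
  have hind := hP.iIndepFun_count (fun c : s.range => s ⁻¹' {(c : ℝ)} ∩ B) hm hbd (by
    intro c c' h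
    refine (Disjoint.preimage _ ?_).mono Set.inter_subset_left Set.inter_subset_left
    simpa using fun h' => h (Subtype.ext h'))
  have hind' : iIndepFun (fun (c : s.range) ω =>
      (c : ℝ) * ((P ω).count (s ⁻¹' {(c : ℝ)} ∩ B) : ℝ)) μ :=
    hind.comp (fun c n => (c : ℝ) * (n : ℝ)) fun c => measurable_from_top
  have h1 := congrFun (hind'.charFun_map_fun_sum_eq_prod
    fun c => ((hmc c).const_mul _).aemeasurable) 1
  have h2 : ∫ z in B, (Complex.exp (s z * Complex.I) - 1) =
      ∑ c : s.range, volume.real (s ⁻¹' {(c : ℝ)} ∩ B) *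
        (Complex.exp ((c : ℝ) * Complex.I) - 1) := by
    have : IsFiniteMeasure (volume.restrict B) := ⟨by simpa using hb.measure_lt_top⟩
    -- The subtracted term is zero; it makes the composed function visibly vanish at `0`, as the
    -- formula requires.
    have := SimpleFunc.map_integral (μ := volume.restrict B) s
      (fun c : ℝ => Complex.exp (c * Complex.I) - 1 - (Complex.exp ((0:ℝ) * Complex.I) - 1))
      (SimpleFunc.integrable_of_isFiniteMeasure s) (by simp)
    rw [SimpleFunc.integral_eq_integral _ (SimpleFunc.integrable_of_isFiniteMeasure _)] at this
    simp only [SimpleFunc.coe_map, Function.comp_def, Complex.ofReal_zero, zero_mul,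
      Complex.exp_zero, sub_self, sub_zero] at this
    rw [this, Finset.sum_coe_sort s.range (fun c => (volume.real (s ⁻¹' {c} ∩ B) : ℂ) *
        (Complex.exp (c * Complex.I) - 1))]
    refine Finset.sum_congr rfl fun c _ => ?_
    rw [measureReal_restrict_apply (s.measurableSet_preimage _), Complex.real_smul]
  rw [charFun_apply_real, integral_map] at h1
  · simp only [Configuration.sumOver_simpleFunc _ hb]
    simp only [Complex.ofReal_one, one_mul] at h1
    rw [h1, Finset.prod_apply, h2, Finset.mul_sum, Complex.exp_sum]
    refine Finset.prod_congr rfl fun c _ => ?_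
    rw [charFun_map_mul_comp (hmc c).aemeasurable, mul_one, hP.charFun_count (hm c) (hbd c),
      mul_assoc]
  · exact Finset.aemeasurable_fun_sum _ fun c _ => ((hmc c).const_mul _).aemeasurable
  · exact (by fun_prop : Measurable _).aestronglyMeasurable

/-- The characteristic functional of a homogeneous Poisson process. -/
theorem integral_cexp_sumOver [IsProbabilityMeasure μ] (hP : IsHomogeneousPoissonProcess P ρ μ)
    {B : Set (EuclideanSpace ℝ (Fin d))} (hB : MeasurableSet B) (hb : Bornology.IsBounded B)
    {g : EuclideanSpace ℝ (Fin d) → ℝ} (hg : Measurable g) :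
    ∫ ω, Complex.exp ((P ω).sumOver B g * Complex.I) ∂μ =
      Complex.exp (ρ * ∫ z in B, (Complex.exp (g z * Complex.I) - 1)) := by
  have : IsFiniteMeasure (volume.restrict B) := ⟨by simpa using hb.measure_lt_top⟩
  have hlim := hg.stronglyMeasurable.tendsto_approx
  set s := hg.stronglyMeasurable.approx
  refine tendsto_nhds_unique (f := fun n => ∫ ω, Complex.exp ((P ω).sumOver B (s n) * Complex.I) ∂μ)
    (l := atTop) ?_ ?_
  · refine tendsto_integral_of_dominated_convergence (fun _ => 1) (fun n => ?_)
      (integrable_const _) (fun n => ?_) ?_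
    · have := hP.measurable_sumOver hB hb (s n).measurable
      exact (by fun_prop : Measurable _).aestronglyMeasurable
    · exact ae_of_all _ fun ω => by rw [Complex.norm_exp_ofReal_mul_I]
    · refine ae_of_all _ fun ω => ?_
      have := (P ω).tendsto_sumOver hb hlim
      exact ((Complex.continuous_ofReal.tendsto _).comp this |>.mul_const _).cexp
  · simp only [hP.integral_cexp_sumOver_simpleFunc hB hb]
    refine (Tendsto.const_mul _ ?_).cexp
    refine tendsto_integral_of_dominated_convergence (fun _ => 2) (fun n => ?_)
      (integrable_const _) (fun n => ?_) ?_
    · have := (s n).measurable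
      exact (by fun_prop : Measurable _).aestronglyMeasurable
    · refine ae_of_all _ fun z => (norm_sub_le _ _).trans ?_
      rw [Complex.norm_exp_ofReal_mul_I, norm_one]
      norm_num
    · exact ae_of_all _ fun z => (((Complex.continuous_ofReal.tendsto _).comp (hlim z)
        |>.mul_const _).cexp).sub_const _

lemma charFun_sumOver [IsProbabilityMeasure μ] (hP : IsHomogeneousPoissonProcess P ρ μ)
    {B : Set (EuclideanSpace ℝ (Fin d))} (hB : MeasurableSet B) (hb : Bornology.IsBounded B)
    {g : EuclideanSpace ℝ (Fin d) → ℝ} (hg : Measurable g) (t : ℝ) :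
    charFun (μ.map fun ω => (P ω).sumOver B g) t =
      Complex.exp (ρ * ∫ z in B, (Complex.exp ((t * g z : ℝ) * Complex.I) - 1)) := by
  rw [← hP.integral_cexp_sumOver hB hb (hg.const_mul t), charFun_apply_real, integral_map
    (hP.measurable_sumOver hB hb hg).aemeasurable
    (by fun_prop : Measurable _).aestronglyMeasurable]
  simp only [Configuration.sumOver_const_mul _ hb]
  push_cast
  rfl

/-- Sums over disjoint sets are independent. -/
theorem iIndepFun_sumOver [IsProbabilityMeasure μ] (hP : IsHomogeneousPoissonProcess P ρ μ)
    {ι : Type*} (B : ι → Set (EuclideanSpace ℝ (Fin d))) (hB : ∀ i, MeasurableSet (B i))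
    (hb : ∀ i, Bornology.IsBounded (B i)) (hd : Pairwise fun i j => Disjoint (B i) (B j))
    {g : EuclideanSpace ℝ (Fin d) → ℝ} (hg : Measurable g) :
    iIndepFun (fun i ω => (P ω).sumOver (B i) g) μ := by
  classical
  rw [iIndepFun_iff_finset]
  intro S
  have hm : ∀ i, Measurable fun ω => (P ω).sumOver (B i) g :=
    fun i => hP.measurable_sumOver (hB i) (hb i) hg
  change iIndepFun (fun (i : S) ω => (P ω).sumOver (B i) g) μ
  rw [iIndepFun_iff_charFun_pi (ι := S) (E := fun _ => ℝ) fun i => (hm i).aemeasurable]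
  intro t
  set U : Set (EuclideanSpace ℝ (Fin d)) := ⋃ i : S, B i
  have hU : MeasurableSet U := MeasurableSet.iUnion fun i => hB i
  have hUb : Bornology.IsBounded U := Bornology.isBounded_iUnion.2 fun i => hb i
  -- The joint characteristic function at `t` is the characteristic functional of this single
  -- function, and it factors because the integral over the disjoint union is additive.
  let h : EuclideanSpace ℝ (Fin d) → ℝ :=
    fun z => ∑ i : S, t i * (B i).indicator g z
  have hh : Measurable h :=
    Finset.measurable_sum _ fun i _ => (hg.indicator (hB i)).const_mul _
  have hsum : ∀ ω, (P ω).sumOver U h = ∑ i : S, t i * (P ω).sumOver (B i) g := by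
    intro ω
    simp only [h]
    rw [Configuration.sumOver_finset_sum _ hUb]
    refine Finset.sum_congr rfl fun i _ => ?_
    rw [Configuration.sumOver_const_mul _ hUb,
      Configuration.sumOver_indicator _ (Set.subset_iUnion (fun i : S => B i) i)]
  have key := hP.integral_cexp_sumOver hU hUb hh
  have : IsFiniteMeasure (volume.restrict U) := ⟨by simpa using hUb.measure_lt_top⟩
  rw [charFun_apply, integral_map]
  rotate_left
  · exact (by fun_prop : Measurable _).aemeasurable
  · exact (by fun_prop : Measurable _).aestronglyMeasurable
  simp only [PiLp.inner_apply, Real.inner_apply]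
  rw [integral_iUnion (fun i : S => hB i) (fun i j hij => hd (Subtype.coe_injective.ne hij))] at key
  · rw [tsum_fintype, Finset.mul_sum, Complex.exp_sum] at key
    rw [← integral_congr_ae (μ := μ)
      (f := fun ω => Complex.exp ((P ω).sumOver U h * Complex.I)), key]
    · refine Finset.prod_congr rfl fun i _ => ?_
      rw [hP.charFun_sumOver (hB i) (hb i) hg]
      congr 2
      refine setIntegral_congr_fun (hB i) fun z hz => ?_
      have : h z = t i * g z := by
        simp only [h]
        rw [Finset.sum_eq_single i]
        · simp [hz]
        · intro j _ hj
          have : z ∉ B j := fun hz' => (hd (Subtype.coe_injective.ne hj)).le_bot ⟨hz', hz⟩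
          simp [this]
        · simp
      simp only [this]
    · refine ae_of_all _ fun ω => ?_
      simp only [hsum]
      congr 3
      exact Finset.sum_congr rfl fun i _ => mul_comm _ _
  · refine Integrable.of_bound (C := 2) (by fun_prop : Measurable _).aestronglyMeasurable
      (ae_of_all _ fun z => (norm_sub_le _ _).trans ?_)
    rw [Complex.norm_exp_ofReal_mul_I, norm_one]
    norm_num

end IsHomogeneousPoissonProcess

/-! ### The Coulomb kernel and the characteristic exponent. -/

section Kernel

variable {d : ℕ}

/-- The Coulomb kernel `y / ‖y‖ ^ d`. -/
noncomputable def coulombKernel (y : EuclideanSpace ℝ (Fin d)) : EuclideanSpace ℝ (Fin d) :=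
  (‖y‖ ^ d)⁻¹ • y

@[fun_prop]
lemma measurable_coulombKernel :
    Measurable (coulombKernel : EuclideanSpace ℝ (Fin d) → EuclideanSpace ℝ (Fin d)) := by
  unfold coulombKernel
  fun_prop

lemma coulombKernel_zero : coulombKernel (0 : EuclideanSpace ℝ (Fin d)) = 0 := by
  simp [coulombKernel]

lemma coulombKernel_neg (y : EuclideanSpace ℝ (Fin d)) :
    coulombKernel (-y) = -coulombKernel y := by
  simp [coulombKernel]

lemma norm_coulombKernel_le (hd : 3 ≤ d) (y : EuclideanSpace ℝ (Fin d)) :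
    ‖coulombKernel y‖ ≤ (‖y‖ ^ (d - 1))⁻¹ := by
  rcases eq_or_ne y 0 with rfl | hy
  · rw [coulombKernel_zero, norm_zero]
    positivity
  · have h0 : 0 < ‖y‖ := norm_pos_iff.2 hy
    have hp : ‖y‖ ^ d = ‖y‖ ^ (d - 1) * ‖y‖ := by rw [← pow_succ]; congr 1; omega
    rw [coulombKernel, norm_smul, norm_inv, norm_pow, norm_norm, hp]
    refine le_of_eq ?_
    field_simp

lemma coulombKernel_smul (hd : 3 ≤ d) {r : ℝ} (hr : 0 < r) (y : EuclideanSpace ℝ (Fin d)) :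
    coulombKernel (r • y) = (r ^ (d - 1))⁻¹ • coulombKernel y := by
  have hp : r ^ d = r ^ (d - 1) * r := by rw [← pow_succ]; congr 1; omega
  rw [coulombKernel, coulombKernel, norm_smul, mul_pow, smul_smul, smul_smul, Real.norm_eq_abs,
    abs_of_pos hr, hp]
  congr 1
  field_simp

lemma integrableOn_norm_coulombKernel_sq (hd : 3 ≤ d) :
    IntegrableOn (fun y : EuclideanSpace ℝ (Fin d) => ‖coulombKernel y‖ ^ 2) {y | 1 ≤ ‖y‖} := by
  have hS : MeasurableSet {y : EuclideanSpace ℝ (Fin d) | 1 ≤ ‖y‖} :=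
    measurableSet_le (by fun_prop) (by fun_prop)
  have h := integrable_one_add_norm (E := EuclideanSpace ℝ (Fin d)) (μ := volume)
    (r := ((2 * (d - 1) : ℕ) : ℝ)) (by
      rw [finrank_euclideanSpace_fin]
      exact_mod_cast (by omega : d < 2 * (d - 1)))
  refine ((h.const_mul (2 ^ (2 * (d - 1)))).integrableOn (s := {y | 1 ≤ ‖y‖})).mono'
    (by fun_prop : Measurable _).aestronglyMeasurable ?_
  refine (ae_restrict_iff' hS).2 (ae_of_all _ fun y (hy : 1 ≤ ‖y‖) => ?_)
  rw [Real.norm_of_nonneg (by positivity), Real.rpow_neg (by positivity), Real.rpow_natCast]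
  calc ‖coulombKernel y‖ ^ 2 ≤ ((‖y‖ ^ (d - 1))⁻¹) ^ 2 := by
        gcongr
        exact norm_coulombKernel_le hd y
    _ = (‖y‖ ^ (2 * (d - 1)))⁻¹ := by rw [inv_pow, ← pow_mul, mul_comm 2]
    -- On this set `(1 + ‖y‖) / 2 ≤ ‖y‖`, which allows comparison with the integrable power of `1 +
    -- ‖y‖`.
    _ ≤ (((1 + ‖y‖) / 2) ^ (2 * (d - 1)))⁻¹ := by
        gcongr
        linarith
    _ = 2 ^ (2 * (d - 1)) * ((1 + ‖y‖) ^ (2 * (d - 1)))⁻¹ := by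
        rw [div_pow, inv_div, div_eq_mul_inv]

lemma inner_coulombKernel_sq_le (y t : EuclideanSpace ℝ (Fin d)) :
    inner ℝ (coulombKernel y) t ^ 2 ≤ ‖t‖ ^ 2 * ‖coulombKernel y‖ ^ 2 := by
  rw [← mul_pow, ← sq_abs, mul_comm]
  gcongr
  exact abs_real_inner_le_norm _ _

lemma integrableOn_inner_coulombKernel_sq (hd : 3 ≤ d) (t : EuclideanSpace ℝ (Fin d)) :
    IntegrableOn (fun y : EuclideanSpace ℝ (Fin d) => inner ℝ (coulombKernel y) t ^ 2)
      {y | 1 ≤ ‖y‖} := by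
  refine ((integrableOn_norm_coulombKernel_sq hd).const_mul (‖t‖ ^ 2)).mono'
    (by fun_prop : Measurable _).aestronglyMeasurable (ae_of_all _ fun y => ?_)
  rw [Real.norm_of_nonneg (by positivity)]
  exact inner_coulombKernel_sq_le y t

lemma Real.one_sub_cos_le_sq_div_two (u : ℝ) : 1 - Real.cos u ≤ u ^ 2 / 2 := by
  linarith [Real.one_sub_sq_div_two_le_cos (x := u)]

/-- Away from the origin the integrand is at most half a square-integrable kernel squared; on the
unit ball the singularity is harmless because the integrand is at most `2`. -/
lemma integrable_one_sub_cos_coulombKernel (hd : 3 ≤ d) (t : EuclideanSpace ℝ (Fin d)) :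
    Integrable (fun y : EuclideanSpace ℝ (Fin d) =>
      1 - Real.cos (inner ℝ (coulombKernel y) t)) := by
  have hm : Measurable (fun y : EuclideanSpace ℝ (Fin d) =>
      1 - Real.cos (inner ℝ (coulombKernel y) t)) := by fun_prop
  rw [← integrableOn_univ, ← Set.union_compl_self {y : EuclideanSpace ℝ (Fin d) | 1 ≤ ‖y‖}]
  refine IntegrableOn.union ?_ ?_
  · refine ((integrableOn_inner_coulombKernel_sq hd t).div_const 2).mono'
      hm.aestronglyMeasurable (ae_of_all _ fun y => ?_)
    rw [Real.norm_of_nonneg (sub_nonneg.2 (Real.cos_le_one _))]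
    exact Real.one_sub_cos_le_sq_div_two _
  · refine Measure.integrableOn_of_bounded (M := 2) ?_ hm.aestronglyMeasurable
      (ae_of_all _ fun y => ?_)
    · refine ((Metric.isBounded_ball (x := (0 : EuclideanSpace ℝ (Fin d))) (r := 1)).subset
        fun y hy => ?_).measure_lt_top.ne
      simpa using hy
    · rw [Real.norm_of_nonneg (sub_nonneg.2 (Real.cos_le_one _))]
      linarith [Real.neg_one_le_cos (inner ℝ (coulombKernel y) t)]

/-- The exponent of the characteristic function of the Coulomb force of a Poisson process of
intensity one. -/
noncomputable def coulombExponent (t : EuclideanSpace ℝ (Fin d)) : ℝ :=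
  ∫ y : EuclideanSpace ℝ (Fin d), (1 - Real.cos (inner ℝ (coulombKernel y) t))

lemma coulombExponent_nonneg (t : EuclideanSpace ℝ (Fin d)) : 0 ≤ coulombExponent t :=
  integral_nonneg fun _ => sub_nonneg.2 (Real.cos_le_one _)

lemma coulombExponent_neg (t : EuclideanSpace ℝ (Fin d)) :
    coulombExponent (-t) = coulombExponent t := by
  simp [coulombExponent, inner_neg_right]

lemma coulombExponent_smul (hd : 3 ≤ d) {s : ℝ} (hs : 0 < s) (t : EuclideanSpace ℝ (Fin d)) :
    coulombExponent (s • t) = s ^ ((d : ℝ) / ((d : ℝ) - 1)) * coulombExponent t := by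
  have hd1 : ((d - 1 : ℕ) : ℝ) = (d : ℝ) - 1 := by
    rw [Nat.cast_sub (by omega), Nat.cast_one]
  have hd0 : (d : ℝ) - 1 ≠ 0 := by
    rw [← hd1]
    exact_mod_cast (by omega : d - 1 ≠ 0)
  -- Chosen so that dilating `y` by `r` multiplies the kernel by `s`; the Jacobian `r^{-d}` is then
  -- `s^α`.
  set r : ℝ := s ^ (-1 / ((d : ℝ) - 1)) with hr
  have hr0 : 0 < r := Real.rpow_pos_of_pos hs _
  have h1 : (r ^ (d - 1))⁻¹ = s := by
    rw [hr, ← Real.rpow_natCast, ← Real.rpow_mul hs.le, hd1, div_mul_cancel₀ _ hd0,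
      Real.rpow_neg_one, inv_inv]
  have h2 : (r ^ d)⁻¹ = s ^ ((d : ℝ) / ((d : ℝ) - 1)) := by
    rw [hr, ← Real.rpow_natCast, ← Real.rpow_mul hs.le, ← Real.rpow_neg hs.le]
    congr 1
    ring
  have h3 := Measure.integral_comp_smul (volume : Measure (EuclideanSpace ℝ (Fin d)))
    (fun y => 1 - Real.cos (inner ℝ (coulombKernel y) t)) r
  simp only [coulombKernel_smul hd hr0, h1, finrank_euclideanSpace_fin, real_inner_smul_left] at h3
  rw [h2, abs_of_pos (by positivity), smul_eq_mul] at h3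
  rw [coulombExponent, coulombExponent, ← h3]
  simp only [real_inner_smul_right]

lemma coulombExponent_pos (hd : 3 ≤ d) {t : EuclideanSpace ℝ (Fin d)} (ht : t ≠ 0) :
    0 < coulombExponent t := by
  have ht0 : 0 < ‖t‖ := norm_pos_iff.2 ht
  rw [coulombExponent, integral_pos_iff_support_of_nonneg
    (fun _ => sub_nonneg.2 (Real.cos_le_one _)) (integrable_one_sub_cos_coulombKernel hd t)]
  -- On this nonempty open set the inner product with the kernel lies in `(0, 1]`, so its cosine is
  -- not `1`.
  let U : Set (EuclideanSpace ℝ (Fin d)) := {y | 1 < ‖y‖} ∩ {y | ‖t‖ < ‖y‖} ∩ {y | 0 < inner ℝ y t}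
  have hU : IsOpen U := ((isOpen_lt (by fun_prop) (by fun_prop)).inter
    (isOpen_lt (by fun_prop) (by fun_prop))).inter (isOpen_lt (by fun_prop) (by fun_prop))
  have hne : U.Nonempty := by
    refine ⟨((2 + ‖t‖) / ‖t‖) • t, ?_⟩
    have : ‖((2 + ‖t‖) / ‖t‖) • t‖ = 2 + ‖t‖ := by
      rw [norm_smul, Real.norm_of_nonneg (by positivity)]
      field_simp
    refine ⟨⟨?_, ?_⟩, ?_⟩
    · simp only [Set.mem_ofPred_eq, this]; linarith
    · simp only [Set.mem_ofPred_eq, this]; linarith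
    · simp only [Set.mem_ofPred_eq, real_inner_smul_left, real_inner_self_eq_norm_sq]
      positivity
  refine (hU.measure_pos volume hne).trans_le (measure_mono fun y hy => ?_)
  obtain ⟨⟨hy1 : 1 < ‖y‖, hyt : ‖t‖ < ‖y‖⟩, hy0 : 0 < inner ℝ y t⟩ := hy
  have hpos : 0 < inner ℝ (coulombKernel y) t := by
    rw [coulombKernel, real_inner_smul_left]
    positivity
  have hlt : inner ℝ (coulombKernel y) t ≤ 1 := by
    calc inner ℝ (coulombKernel y) t ≤ ‖coulombKernel y‖ * ‖t‖ := real_inner_le_norm _ _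
      _ ≤ (‖y‖ ^ (d - 1))⁻¹ * ‖t‖ := by
        gcongr
        exact norm_coulombKernel_le hd y
      _ ≤ ‖y‖⁻¹ * ‖y‖ := by
        gcongr
        exact le_self_pow₀ hy1.le (by omega)
      _ = 1 := inv_mul_cancel₀ (by positivity)
  have hpi := Real.pi_gt_three
  rw [Function.mem_support, sub_ne_zero]
  intro h
  exact hpos.ne' ((Real.cos_eq_one_iff_of_lt_of_lt (by linarith) (by linarith)).1 h.symm)

end Kernel

/-! ### Symmetric laws and second moments from characteristic functions. -/

section Symmetric

/-- The imaginary part is the integral of the odd function `sin ∘ h` over a symmetric set, hence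
zero. -/
lemma integral_symmetric_cexp_sub_one {E : Type*} [NormedAddCommGroup E] [MeasurableSpace E]
    [BorelSpace E] {ν : Measure E} [ν.IsNegInvariant] {S : Set E} (hS : MeasurableSet S)
    (hfin : ν S ≠ ∞) (hsymm : ∀ y, -y ∈ S ↔ y ∈ S) {h : E → ℝ} (hm : Measurable h)
    (hodd : ∀ y, h (-y) = -h y) :
    ∫ y in S, (Complex.exp (h y * Complex.I) - 1) ∂ν =
      ((-∫ y in S, (1 - Real.cos (h y)) ∂ν : ℝ) : ℂ) := by
  have : IsFiniteMeasure (ν.restrict S) := ⟨by simpa using hfin.lt_top⟩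
  have hsin : ∫ y in S, Real.sin (h y) ∂ν = 0 := by
    have h1 : ∫ y in S, Real.sin (h y) ∂ν = -∫ y in S, Real.sin (h y) ∂ν := by
      conv_lhs => rw [← integral_indicator hS, ← integral_neg_eq_self]
      rw [← integral_neg, ← integral_indicator hS]
      congr 1
      ext y
      by_cases hy : y ∈ S
      · rw [Set.indicator_of_mem hy, Set.indicator_of_mem ((hsymm y).2 hy), hodd, Real.sin_neg]
      · rw [Set.indicator_of_notMem hy, Set.indicator_of_notMem (mt (hsymm y).1 hy)]
    linarith
  have hcos : Integrable (fun y => 1 - Real.cos (h y)) (ν.restrict S) :=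
    Integrable.of_bound (C := 2) (by fun_prop : Measurable _).aestronglyMeasurable
      (ae_of_all _ fun y => by
        rw [Real.norm_of_nonneg (sub_nonneg.2 (Real.cos_le_one _))]
        linarith [Real.neg_one_le_cos (h y)])
  have hsi : Integrable (fun y => Real.sin (h y)) (ν.restrict S) :=
    Integrable.of_bound (C := 1) (by fun_prop : Measurable _).aestronglyMeasurable
      (ae_of_all _ fun y => by
        rw [Real.norm_eq_abs]
        exact Real.abs_sin_le_one _)
  have heq : ∀ y, Complex.exp (h y * Complex.I) - 1 =
      ((-(1 - Real.cos (h y)) : ℝ) : ℂ) + (Real.sin (h y) : ℝ) * Complex.I := by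
    intro y
    rw [Complex.exp_mul_I]
    push_cast
    ring
  simp only [heq]
  rw [integral_add hcos.neg.ofReal (hsi.ofReal.mul_const _), integral_mul_const,
    integral_complex_ofReal, integral_complex_ofReal, hsin, integral_neg]
  simp

/-- A law whose characteristic function is real is symmetric. -/
lemma map_neg_eq_of_charFun_neg {E : Type*} [NormedAddCommGroup E] [InnerProductSpace ℝ E]
    [CompleteSpace E] [SecondCountableTopology E] [MeasurableSpace E] [BorelSpace E]
    {m : Measure E} [IsFiniteMeasure m] (h : ∀ t, charFun m (-t) = charFun m t) :
    m.map (fun y => -y) = m := by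
  have : (fun y : E => -y) = fun y => (-1 : ℝ) • y := by ext; simp
  rw [this]
  refine Measure.ext_of_charFun (funext fun t => ?_)
  rw [charFun_map_smul, neg_one_smul, h]

lemma integral_eq_zero_of_map_neg {E : Type*} [NormedAddCommGroup E] [NormedSpace ℝ E]
    [MeasurableSpace E] [BorelSpace E] [SecondCountableTopology E]
    {m : Measure E} (h : m.map (fun y => -y) = m) : ∫ y, y ∂m = 0 := by
  have h1 : ∫ y, y ∂m = -∫ y, y ∂m := by
    conv_lhs => rw [← h]
    rw [integral_map (by fun_prop) (by fun_prop), integral_neg]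
  have h2 : (2 : ℝ) • ∫ y, y ∂m = 0 := by
    rw [two_smul]
    exact add_eq_zero_iff_eq_neg.2 h1
  exact (smul_eq_zero.1 h2).resolve_left two_ne_zero

lemma integral_one_sub_cos_inner {E : Type*} [NormedAddCommGroup E] [InnerProductSpace ℝ E]
    [SecondCountableTopology E] [MeasurableSpace E] [BorelSpace E]
    (m : Measure E) [IsProbabilityMeasure m] (t : E) :
    ∫ y, (1 - Real.cos (inner ℝ y t)) ∂m = 1 - (charFun m t).re := by
  have hi : Integrable (fun y : E => Complex.exp ((inner ℝ y t : ℝ) * Complex.I)) m := by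
    refine Integrable.of_bound (C := 1) (by fun_prop : Measurable _).aestronglyMeasurable
      (ae_of_all _ fun y => ?_)
    rw [Complex.norm_exp_ofReal_mul_I]
  have h1 := integral_re hi
  have h2 : ∀ y : E, RCLike.re (Complex.exp ((inner ℝ y t : ℝ) * Complex.I)) =
      Real.cos (inner ℝ y t) := fun y => Complex.exp_ofReal_mul_I_re _
  simp only [h2] at h1
  rw [integral_sub (integrable_const _), charFun_apply, h1]
  · simp
  · have := hi.re
    simpa only [h2] using this

/-- Fatou's lemma bounds the second moment by the behaviour of the characteristic function
near the origin. -/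
lemma lintegral_sq_le_of_charFun {m : Measure ℝ} [IsProbabilityMeasure m] {C : ℝ}
    (h : ∀ t, 1 - (charFun m t).re ≤ C * t ^ 2 / 2) :
    ∫⁻ y, ENNReal.ofReal (y ^ 2) ∂m ≤ ENNReal.ofReal C := by
  have hre : ∀ t, ∫ y, (1 - Real.cos (t * y)) ∂m = 1 - (charFun m t).re := fun t => by
    rw [← integral_one_sub_cos_inner]
    simp only [Real.inner_apply, mul_comm]
  -- With `s = 1/(n+1)` the expression is `2(1 - cos(sy))/s²`; the half-angle formula turns it into
  -- `y² sinc²(sy/2)`.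
  have hlim : ∀ y : ℝ, Tendsto
      (fun n : ℕ => 2 * ((n : ℝ) + 1) ^ 2 * (1 - Real.cos (1 / ((n : ℝ) + 1) * y))) atTop
      (𝓝 (y ^ 2)) := by
    intro y
    have hs : Tendsto (fun n : ℕ => (1 : ℝ) / ((n : ℝ) + 1) * y / 2) atTop (𝓝 0) := by
      simpa using (tendsto_one_div_add_atTop_nhds_zero_nat.mul_const y).div_const 2
    have h1 := ((Real.continuous_sinc.tendsto 0).comp hs).pow 2 |>.mul_const (y ^ 2)
    rw [Real.sinc_zero, one_pow, one_mul] at h1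
    refine h1.congr fun n => ?_
    have hn : (0 : ℝ) < (n : ℝ) + 1 := by positivity
    rcases eq_or_ne y 0 with rfl | hy
    · simp
    · have hne : (1 : ℝ) / ((n : ℝ) + 1) * y / 2 ≠ 0 := by positivity
      have hc : Real.cos (1 / ((n : ℝ) + 1) * y) =
          1 - 2 * Real.sin (1 / ((n : ℝ) + 1) * y / 2) ^ 2 := by
        have := Real.cos_two_mul (1 / ((n : ℝ) + 1) * y / 2)
        rw [mul_div_cancel₀ _ (two_ne_zero)] at this
        rw [this]
        linarith [Real.cos_sq_add_sin_sq (1 / ((n : ℝ) + 1) * y / 2)]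
      rw [Function.comp_apply, Real.sinc_of_ne_zero hne, hc]
      field_simp
      ring
  calc ∫⁻ y, ENNReal.ofReal (y ^ 2) ∂m
      = ∫⁻ y, liminf (fun n : ℕ => ENNReal.ofReal
          (2 * ((n : ℝ) + 1) ^ 2 * (1 - Real.cos (1 / ((n : ℝ) + 1) * y)))) atTop ∂m := by
        refine lintegral_congr fun y => ?_
        exact ((ENNReal.continuous_ofReal.tendsto _).comp (hlim y)).liminf_eq.symm
    _ ≤ liminf (fun n : ℕ => ∫⁻ y, ENNReal.ofReal
          (2 * ((n : ℝ) + 1) ^ 2 * (1 - Real.cos (1 / ((n : ℝ) + 1) * y))) ∂m) atTop :=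
        lintegral_liminf_le fun n => by fun_prop
    _ ≤ liminf (fun _ : ℕ => ENNReal.ofReal C) atTop := by
        refine liminf_le_liminf (Eventually.of_forall fun n => ?_)
        rw [← ofReal_integral_eq_lintegral_ofReal]
        · refine ENNReal.ofReal_le_ofReal ?_
          rw [integral_const_mul, hre]
          refine (mul_le_mul_of_nonneg_left (h _) (by positivity)).trans_eq ?_
          field_simp
        · refine Integrable.of_bound (C := 2 * ((n : ℝ) + 1) ^ 2 * 2)
            (by fun_prop : Measurable _).aestronglyMeasurable (ae_of_all _ fun y => ?_)
          rw [Real.norm_of_nonneg (mul_nonneg (by positivity)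
            (sub_nonneg.2 (Real.cos_le_one _)))]
          gcongr
          linarith [Real.neg_one_le_cos (1 / ((n : ℝ) + 1) * y)]
        · exact ae_of_all _ fun y => mul_nonneg (by positivity) (sub_nonneg.2 (Real.cos_le_one _))
    _ = ENNReal.ofReal C := by simp

end Symmetric

/-! ### Convergence of random series. -/

section Series

/-- **Kolmogorov's convergence theorem**: a series of independent centred random variables with
bounded second moments of the partial sums converges almost surely. -/
theorem ae_exists_tendsto_sum_of_iIndepFun {Ω : Type*} [MeasurableSpace Ω] {μ : Measure Ω}
    [IsProbabilityMeasure μ] {W : ℕ → Ω → ℝ} (hW : ∀ k, Measurable (W k)) (hind : iIndepFun W μ)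
    (hint : ∀ k, Integrable (W k) μ) (h0 : ∀ k, ∫ ω, W k ω ∂μ = 0) {C : ℝ≥0}
    (hC : ∀ n, ∫⁻ ω, ENNReal.ofReal ((∑ k ∈ Finset.range n, W k ω) ^ 2) ∂μ ≤ C) :
    ∀ᵐ ω ∂μ, ∃ l, Tendsto (fun n => ∑ k ∈ Finset.range n, W k ω) atTop (𝓝 l) := by
  have hsm : ∀ k, StronglyMeasurable (W k) := fun k => (hW k).stronglyMeasurable
  let 𝒢 := Filtration.natural W hsm
  -- With `n + 1` terms, `S n` is measurable for the σ-algebra of `W 0, …, W n`; the shift is undone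
  -- at the end.
  let S : ℕ → Ω → ℝ := fun n ω => ∑ k ∈ Finset.range (n + 1), W k ω
  have hS : StronglyAdapted 𝒢 S := fun n =>
    Finset.stronglyMeasurable_fun_sum _ fun k hk =>
      ((Filtration.stronglyAdapted_natural hsm) k).mono
        (𝒢.mono (Nat.lt_succ_iff.1 (Finset.mem_range.1 hk)))
  have hSi : ∀ n, Integrable (S n) μ := fun n => integrable_finsetSum _ fun k _ => hint k
  have hmart : Martingale S 𝒢 μ := by
    refine martingale_nat hS hSi fun n => ?_
    have h1 : S (n + 1) = S n + W (n + 1) := by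
      ext ω
      simp only [S, Pi.add_apply]
      rw [Finset.sum_range_succ _ (n + 1)]
    have h2 := hind.condExp_natural_ae_eq_of_lt hsm n.lt_succ_self
    rw [h0] at h2
    rw [h1]
    have h3 := condExp_add (hSi n) (hint (n + 1)) (𝒢 n)
    rw [condExp_of_stronglyMeasurable (𝒢.le n) (hS n) (hSi n)] at h3
    filter_upwards [h2, h3] with ω h2 h3
    rw [h3, Pi.add_apply]
    change _ = _ + (μ[W (n + 1) | Filtration.natural W hsm n]) ω
    rw [h2, add_zero]
  -- The `L¹` bound needed for martingale convergence follows from `|u| ≤ 1 + u²`.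
  have hbd : ∀ n, eLpNorm (S n) 1 μ ≤ ((1 + C : ℝ≥0) : ℝ≥0∞) := by
    intro n
    rw [eLpNorm_one_eq_lintegral_enorm]
    calc ∫⁻ ω, ‖S n ω‖ₑ ∂μ ≤ ∫⁻ ω, (1 + ENNReal.ofReal (S n ω ^ 2)) ∂μ := by
          refine lintegral_mono fun ω => ?_
          rw [← ofReal_norm, ← ENNReal.ofReal_one, ← ENNReal.ofReal_add zero_le_one (sq_nonneg _)]
          refine ENNReal.ofReal_le_ofReal ?_
          rw [Real.norm_eq_abs]
          nlinarith [sq_abs (S n ω), sq_nonneg (|S n ω| - 1), abs_nonneg (S n ω)]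
      _ ≤ 1 + C := by
          rw [lintegral_add_left measurable_const, lintegral_const, measure_univ, mul_one]
          gcongr
          exact hC (n + 1)
      _ = ((1 + C : ℝ≥0) : ℝ≥0∞) := by push_cast; rfl
  filter_upwards [hmart.submartingale.exists_ae_tendsto_of_bdd hbd] with ω ⟨l, hl⟩
  exact ⟨l, (tendsto_add_atTop_iff_nat 1).1 hl⟩

end Series

/-! ### The second moment of a Poisson variable. -/

section Poisson

lemma lintegral_sq_poissonMeasure_lt_top (r : ℝ≥0) :
    ∫⁻ n : ℕ, ENNReal.ofReal ((n : ℝ) ^ 2) ∂(poissonMeasure r) < ∞ := by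
  have h : Integrable (fun n : ℕ => (n : ℝ) ^ 2) (poissonMeasure r) := by
    rw [integrable_poissonMeasure_iff]
    have hs := (Real.summable_pow_div_factorial (r * Real.exp 1)).mul_left (2 * Real.exp (-r))
    refine hs.of_nonneg_of_le (fun n => by positivity) fun n => ?_
    -- Absorbing `n²` into `2eⁿ` leaves an exponential series with parameter `re`.
    have h1 : (n : ℝ) ^ 2 ≤ 2 * Real.exp 1 ^ n := by
      have := Real.quadratic_le_exp_of_nonneg (x := n) (by positivity)
      rw [← Real.exp_nat_mul, mul_one]
      nlinarith [(Nat.cast_nonneg n : (0 : ℝ) ≤ n)]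
    rw [Real.norm_of_nonneg (by positivity), mul_pow]
    calc Real.exp (-r) * r ^ n / n.factorial * (n : ℝ) ^ 2
        ≤ Real.exp (-r) * r ^ n / n.factorial * (2 * Real.exp 1 ^ n) := by gcongr
      _ = _ := by ring
  have h2 := h.2
  rw [hasFiniteIntegral_iff_ofReal (ae_of_all _ fun n => by positivity)] at h2
  exact h2

end Poisson

/-! ### Truncated forces as sums over the process, with their moments. -/

namespace Configuration

variable {d : ℕ}

/-- Removing `x` makes no difference, because the kernel takes the value `0` at the origin. -/
lemma truncatedForce_eq_sum (X : Configuration d) (x : EuclideanSpace ℝ (Fin d)) (R : ℝ) :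
    X.truncatedForce x R =
      ∑ z ∈ (X.locallyFinite (Metric.ball x R) Metric.isBounded_ball).toFinset,
        coulombKernel (x - z) := by
  refine finsum_mem_eq_sum_of_inter_support_eq (fun z => coulombKernel (x - z)) ?_
  ext z
  simp only [Set.mem_inter_iff, Set.mem_sdiff, Set.mem_singleton_iff, Function.mem_support,
    Finset.mem_coe, Set.Finite.mem_toFinset]
  refine ⟨fun h => ⟨⟨h.1.1.1, h.1.2⟩, h.2⟩, fun h => ⟨⟨⟨h.1.1, ?_⟩, h.1.2⟩, h.2⟩⟩
  rintro rfl
  exact h.2 (by rw [sub_self, coulombKernel_zero])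

lemma inner_truncatedForce (X : Configuration d) (x t : EuclideanSpace ℝ (Fin d)) (R : ℝ) :
    inner ℝ (X.truncatedForce x R) t =
      X.sumOver (Metric.ball x R) (fun z => inner ℝ (coulombKernel (x - z)) t) := by
  rw [truncatedForce_eq_sum, sum_inner, sumOver_eq_sum _ Metric.isBounded_ball]

lemma abs_sumOver_le (X : Configuration d) {A B : Set (EuclideanSpace ℝ (Fin d))} (hAB : A ⊆ B)
    (hB : Bornology.IsBounded B) {g : EuclideanSpace ℝ (Fin d) → ℝ} {C : ℝ} (hC : 0 ≤ C)
    (h : ∀ z ∈ A, |g z| ≤ C) : |X.sumOver A g| ≤ X.count B * C := by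
  rw [sumOver_eq_sum X (hB.subset hAB), count_eq_card X hB]
  refine (Finset.abs_sum_le_sum_abs _ _).trans ((Finset.sum_le_card_nsmul _ _ C ?_).trans ?_)
  · intro z hz
    exact h z ((Set.Finite.mem_toFinset _).1 hz).2
  · rw [nsmul_eq_mul]
    gcongr

end Configuration

lemma isBounded_preimage_sub_left {E : Type*} [SeminormedAddCommGroup E] {S : Set E}
    (hb : Bornology.IsBounded S) (x : E) :
    Bornology.IsBounded ((fun z => x - z) ⁻¹' S) := by
  have : (fun z => x - z) ⁻¹' S = (fun z => x - z) '' S := by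
    ext z
    simp only [Set.mem_preimage, Set.mem_image]
    exact ⟨fun h => ⟨x - z, h, sub_sub_self _ _⟩, fun ⟨w, hw, h⟩ => by rwa [← h, sub_sub_self]⟩
  rw [this]
  exact (LipschitzWith.of_dist_le_mul (K := 1) fun a b => by
    rw [dist_sub_left, NNReal.coe_one, one_mul]).isBounded_image hb

namespace IsHomogeneousPoissonProcess

variable {d : ℕ} {Ω : Type*} [MeasurableSpace Ω] {P : Ω → Configuration d} {ρ : ℝ≥0}
  {μ : Measure Ω}

lemma charFun_sumOver_symmetric [IsProbabilityMeasure μ] (hP : IsHomogeneousPoissonProcess P ρ μ)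
    (x t : EuclideanSpace ℝ (Fin d)) {S : Set (EuclideanSpace ℝ (Fin d))} (hS : MeasurableSet S)
    (hb : Bornology.IsBounded S) (hsymm : ∀ y, -y ∈ S ↔ y ∈ S) (s : ℝ) :
    charFun (μ.map fun ω => (P ω).sumOver ((fun z => x - z) ⁻¹' S)
        (fun z => inner ℝ (coulombKernel (x - z)) t)) s =
      ((Real.exp (-(ρ * ∫ y in S, (1 - Real.cos (s * inner ℝ (coulombKernel y) t)))) : ℝ) : ℂ) := by
  have hm : MeasurableSet ((fun z => x - z) ⁻¹' S) := by measurability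
  rw [hP.charFun_sumOver hm (isBounded_preimage_sub_left hb x) (by fun_prop),
    (Measure.measurePreserving_sub_left volume x).setIntegral_preimage_emb
      (MeasurableEquiv.subLeft x).measurableEmbedding
      (fun y => Complex.exp ((s * inner ℝ (coulombKernel y) t : ℝ) * Complex.I) - 1),
    integral_symmetric_cexp_sub_one hS hb.measure_lt_top.ne hsymm (by fun_prop)
      (fun y => by rw [coulombKernel_neg, inner_neg_left, mul_neg])]
  push_cast
  ring_nf

/-- The inequalities `1 - e^{-u} ≤ u` and `1 - cos u ≤ u²/2` give a quadratic bound on the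
characteristic function at the origin. The bound is independent of `S`, so it serves single shells
and all their finite unions alike. -/
lemma lintegral_sumOver_sq_le [IsProbabilityMeasure μ] (hP : IsHomogeneousPoissonProcess P ρ μ)
    (hd : 3 ≤ d) (x t : EuclideanSpace ℝ (Fin d)) {S : Set (EuclideanSpace ℝ (Fin d))}
    (hS : MeasurableSet S) (hb : Bornology.IsBounded S) (hsymm : ∀ y, -y ∈ S ↔ y ∈ S)
    (hS1 : S ⊆ {y | 1 ≤ ‖y‖}) :
    ∫⁻ ω, ENNReal.ofReal ((P ω).sumOver ((fun z => x - z) ⁻¹' S)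
        (fun z => inner ℝ (coulombKernel (x - z)) t) ^ 2) ∂μ ≤
      ENNReal.ofReal (ρ * ∫ y in {y : EuclideanSpace ℝ (Fin d) | 1 ≤ ‖y‖},
        inner ℝ (coulombKernel y) t ^ 2) := by
  have hm : MeasurableSet ((fun z => x - z) ⁻¹' S) := by measurability
  have hZ : Measurable (fun ω => (P ω).sumOver ((fun z => x - z) ⁻¹' S)
        (fun z => inner ℝ (coulombKernel (x - z)) t)) :=
    hP.measurable_sumOver hm (isBounded_preimage_sub_left hb x) (by fun_prop)
  have : IsProbabilityMeasure (μ.map fun ω => (P ω).sumOver ((fun z => x - z) ⁻¹' S)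
        (fun z => inner ℝ (coulombKernel (x - z)) t)) :=
    Measure.isProbabilityMeasure_map hZ.aemeasurable
  have hi := integrableOn_inner_coulombKernel_sq hd t
  rw [← lintegral_map (f := fun y : ℝ => ENNReal.ofReal (y ^ 2)) (by fun_prop) hZ]
  refine lintegral_sq_le_of_charFun fun s => ?_
  rw [hP.charFun_sumOver_symmetric x t hS hb hsymm, Complex.ofReal_re]
  have h1 : ∫ y in S, (1 - Real.cos (s * inner ℝ (coulombKernel y) t)) ≤
      ∫ y in S, s ^ 2 / 2 * inner ℝ (coulombKernel y) t ^ 2 := by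
    refine integral_mono_of_nonneg (ae_of_all _ fun _ => sub_nonneg.2 (Real.cos_le_one _))
      ((hi.mono_set hS1).const_mul _) (ae_of_all _ fun y => ?_)
    refine (Real.one_sub_cos_le_sq_div_two _).trans_eq ?_
    ring
  rw [integral_const_mul] at h1
  have h2 : ∫ y in S, inner ℝ (coulombKernel y) t ^ 2 ≤
      ∫ y in {y : EuclideanSpace ℝ (Fin d) | 1 ≤ ‖y‖}, inner ℝ (coulombKernel y) t ^ 2 :=
    setIntegral_mono_set hi (ae_of_all _ fun _ => sq_nonneg _) hS1.eventuallyLE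
  calc 1 - Real.exp (-(ρ * ∫ y in S, (1 - Real.cos (s * inner ℝ (coulombKernel y) t))))
      ≤ ρ * ∫ y in S, (1 - Real.cos (s * inner ℝ (coulombKernel y) t)) := by
        linarith [Real.one_sub_le_exp_neg
          (ρ * ∫ y in S, (1 - Real.cos (s * inner ℝ (coulombKernel y) t)))]
    _ ≤ ρ * (s ^ 2 / 2 * ∫ y in {y : EuclideanSpace ℝ (Fin d) | 1 ≤ ‖y‖},
          inner ℝ (coulombKernel y) t ^ 2) := by
        gcongr
        exact h1.trans (by gcongr)
    _ = _ := by ring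

lemma integrable_sumOver [IsProbabilityMeasure μ] (hP : IsHomogeneousPoissonProcess P ρ μ)
    (hd : 3 ≤ d) (x t : EuclideanSpace ℝ (Fin d)) {S : Set (EuclideanSpace ℝ (Fin d))}
    (hS : MeasurableSet S) (hb : Bornology.IsBounded S) (hsymm : ∀ y, -y ∈ S ↔ y ∈ S)
    (hS1 : S ⊆ {y | 1 ≤ ‖y‖}) :
    Integrable (fun ω => (P ω).sumOver ((fun z => x - z) ⁻¹' S)
        (fun z => inner ℝ (coulombKernel (x - z)) t)) μ := by
  have hm : MeasurableSet ((fun z => x - z) ⁻¹' S) := by measurability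
  have hZ : Measurable (fun ω => (P ω).sumOver ((fun z => x - z) ⁻¹' S)
        (fun z => inner ℝ (coulombKernel (x - z)) t)) :=
    hP.measurable_sumOver hm (isBounded_preimage_sub_left hb x) (by fun_prop)
  refine MemLp.integrable (q := 2) (by norm_num)
    ((memLp_two_iff_integrable_sq hZ.aestronglyMeasurable).2
      ⟨(hZ.pow_const 2).aestronglyMeasurable, ?_⟩)
  rw [hasFiniteIntegral_iff_ofReal (ae_of_all _ fun _ => sq_nonneg _)]
  exact (hP.lintegral_sumOver_sq_le hd x t hS hb hsymm hS1).trans_lt ENNReal.ofReal_lt_top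

lemma integral_sumOver_eq_zero [IsProbabilityMeasure μ] (hP : IsHomogeneousPoissonProcess P ρ μ)
    (x t : EuclideanSpace ℝ (Fin d)) {S : Set (EuclideanSpace ℝ (Fin d))}
    (hS : MeasurableSet S) (hb : Bornology.IsBounded S) (hsymm : ∀ y, -y ∈ S ↔ y ∈ S) :
    ∫ ω, (P ω).sumOver ((fun z => x - z) ⁻¹' S)
        (fun z => inner ℝ (coulombKernel (x - z)) t) ∂μ = 0 := by
  have hm : MeasurableSet ((fun z => x - z) ⁻¹' S) := by measurability
  have hZ : Measurable (fun ω => (P ω).sumOver ((fun z => x - z) ⁻¹' S)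
        (fun z => inner ℝ (coulombKernel (x - z)) t)) :=
    hP.measurable_sumOver hm (isBounded_preimage_sub_left hb x) (by fun_prop)
  have h := integral_eq_zero_of_map_neg (map_neg_eq_of_charFun_neg
    (m := μ.map fun ω => (P ω).sumOver ((fun z => x - z) ⁻¹' S)
        (fun z => inner ℝ (coulombKernel (x - z)) t)) fun s => by
      simp only [hP.charFun_sumOver_symmetric x t hS hb hsymm, neg_mul, Real.cos_neg])
  rwa [integral_map hZ.aemeasurable (by fun_prop)] at h

end IsHomogeneousPoissonProcess

/-! ### Spherical shells of equal volume. -/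

section Shells

variable {d : ℕ}

/-- The radius of the ball whose volume is `k + 1` times that of the unit ball. -/
noncomputable def shellRadius (d k : ℕ) : ℝ := ((k : ℝ) + 1) ^ (1 / (d : ℝ))

/-- Consecutive spherical shells, all of the volume of the unit ball. -/
def shell (d k : ℕ) : Set (EuclideanSpace ℝ (Fin d)) :=
  {y | shellRadius d k ≤ ‖y‖ ∧ ‖y‖ < shellRadius d (k + 1)}

lemma shellRadius_pos (d k : ℕ) : 0 < shellRadius d k := by
  unfold shellRadius; positivity

lemma shellRadius_pow (hd : 3 ≤ d) (k : ℕ) : shellRadius d k ^ d = k + 1 := by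
  rw [shellRadius, one_div, Real.rpow_inv_natCast_pow (by positivity) (by omega)]

lemma shellRadius_mono (d : ℕ) : Monotone (shellRadius d) := fun k l h => by
  unfold shellRadius
  gcongr

lemma one_le_shellRadius (d k : ℕ) : 1 ≤ shellRadius d k :=
  Real.one_le_rpow (by linarith [(Nat.cast_nonneg k : (0 : ℝ) ≤ k)]) (by positivity)

lemma measurableSet_annulus (a b : ℝ) :
    MeasurableSet {y : EuclideanSpace ℝ (Fin d) | a ≤ ‖y‖ ∧ ‖y‖ < b} :=
  (measurableSet_le measurable_const measurable_norm).inter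
    (measurableSet_lt measurable_norm measurable_const)

lemma measurableSet_shell (d k : ℕ) : MeasurableSet (shell d k) :=
  measurableSet_annulus _ _

lemma isBounded_shell (d k : ℕ) : Bornology.IsBounded (shell d k) :=
  (Metric.isBounded_ball (x := 0) (r := shellRadius d (k + 1))).subset
    fun y hy => by simpa using hy.2

lemma neg_mem_shell_iff (k : ℕ) (y : EuclideanSpace ℝ (Fin d)) :
    -y ∈ shell d k ↔ y ∈ shell d k := by
  simp [shell]

lemma pairwise_disjoint_shell (d : ℕ) : Pairwise fun i j => Disjoint (shell d i) (shell d j) := by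
  have key : ∀ i j, i < j → Disjoint (shell d i) (shell d j) := fun i j hij =>
    Set.disjoint_left.2 fun y hi hj =>
      (hi.2.trans_le ((shellRadius_mono d (Nat.succ_le_of_lt hij)).trans hj.1)).false
  intro i j hij
  rcases hij.lt_or_gt with h | h
  · exact key i j h
  · exact (key j i h).symm

/-- The `d`-th powers of consecutive radii differ by `1`. Equal volumes give all shell counts the
same law. -/
lemma volume_shell (hd : 3 ≤ d) (k : ℕ) :
    volume (shell d k) = volume (Metric.ball (0 : EuclideanSpace ℝ (Fin d)) 1) := by
  have : Nontrivial (EuclideanSpace ℝ (Fin d)) := by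
    have : Nonempty (Fin d) := ⟨⟨0, by omega⟩⟩
    infer_instance
  have h1 : shell d k = Metric.ball 0 (shellRadius d (k + 1)) \ Metric.ball 0 (shellRadius d k) := by
    ext y
    simp [shell, and_comm]
  have hfin := (Metric.isBounded_ball (x := (0 : EuclideanSpace ℝ (Fin d))) (r := 1)).measure_lt_top
    (μ := volume) |>.ne
  rw [h1, measure_sdiff (Metric.ball_subset_ball (shellRadius_mono d k.le_succ))
    measurableSet_ball.nullMeasurableSet Metric.isBounded_ball.measure_lt_top.ne,
    Measure.addHaar_ball _ _ (shellRadius_pos _ _).le,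
    Measure.addHaar_ball _ _ (shellRadius_pos _ _).le, finrank_euclideanSpace_fin,
    shellRadius_pow hd, shellRadius_pow hd, ← ENNReal.sub_mul fun _ _ => hfin,
    ← ENNReal.ofReal_sub _ (by positivity)]
  simp

/-- The terms are `(k+1)^{-2(d-1)/d}`, and `2(d-1)/d > 1`. -/
lemma tsum_shellRadius_lt_top (hd : 3 ≤ d) :
    ∑' k, ENNReal.ofReal (((shellRadius d k ^ (d - 1))⁻¹) ^ 2) ≠ ∞ := by
  have h : Summable fun k : ℕ => (((shellRadius d k ^ (d - 1))⁻¹) ^ 2) := by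
    have h1 := (summable_nat_add_iff 1).2 (Real.summable_nat_rpow
      (p := -(2 * ((d : ℝ) - 1) / d)).2 (by
        have hd' : (3 : ℝ) ≤ d := by exact_mod_cast hd
        rw [neg_lt_neg_iff, lt_div_iff₀ (by linarith)]
        linarith))
    refine h1.congr fun k => ?_
    rw [shellRadius, inv_pow, ← pow_mul, ← Real.rpow_natCast, ← Real.rpow_mul (by positivity),
      ← Real.rpow_neg (by positivity), Nat.cast_mul, Nat.cast_sub (by omega)]
    push_cast
    congr 1
    ring
  exact h.tsum_ofReal_ne_top

lemma volume_preimage_shell (hd : 3 ≤ d) (x : EuclideanSpace ℝ (Fin d)) (k : ℕ) :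
    volume ((fun z => x - z) ⁻¹' shell d k) =
      volume (Metric.ball (0 : EuclideanSpace ℝ (Fin d)) 1) := by
  rw [(Measure.measurePreserving_sub_left volume x).measure_preimage
    (measurableSet_shell d k).nullMeasurableSet, volume_shell hd]

end Shells

/-! ### Truncated forces along and between the shell radii. -/

namespace Configuration

variable {d : ℕ}

lemma inner_truncatedForce_add (X : Configuration d) (x t : EuclideanSpace ℝ (Fin d)) {r R : ℝ}
    (hr : r ≤ R) :
    inner ℝ (X.truncatedForce x R) t = inner ℝ (X.truncatedForce x r) t +
      X.sumOver ((fun z => x - z) ⁻¹' {y | r ≤ ‖y‖ ∧ ‖y‖ < R})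
        (fun z => inner ℝ (coulombKernel (x - z)) t) := by
  have hball : ∀ s, Metric.ball x s = (fun z => x - z) ⁻¹' {y | ‖y‖ < s} := fun s => by
    ext z
    simp [dist_eq_norm, norm_sub_rev]
  have hsub : (fun z => x - z) ⁻¹' {y | r ≤ ‖y‖ ∧ ‖y‖ < R} ⊆ Metric.ball x R := by
    rw [hball]
    exact fun z hz => hz.2
  rw [inner_truncatedForce, inner_truncatedForce,
    ← sumOver_union _ Metric.isBounded_ball (Metric.isBounded_ball.subset hsub)]
  · congr 1
    rw [hball, hball, ← Set.preimage_union]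
    congr 1
    ext y
    simp only [Set.mem_ofPred_eq, Set.mem_union]
    constructor
    · intro h
      by_cases h' : ‖y‖ < r
      · exact Or.inl h'
      · exact Or.inr ⟨not_lt.1 h', h⟩
    · rintro (h | h)
      · exact h.trans_le hr
      · exact h.2
  · rw [hball]
    refine Disjoint.preimage _ (Set.disjoint_left.2 fun y hy hy' => ?_)
    exact (lt_of_lt_of_le hy hy'.1).false

lemma inner_truncatedForce_shellRadius (X : Configuration d) (x t : EuclideanSpace ℝ (Fin d))
    (n : ℕ) :
    inner ℝ (X.truncatedForce x (shellRadius d n)) t =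
      inner ℝ (X.truncatedForce x (shellRadius d 0)) t +
      ∑ k ∈ Finset.range n, X.sumOver ((fun z => x - z) ⁻¹' shell d k)
        (fun z => inner ℝ (coulombKernel (x - z)) t) := by
  induction n with
  | zero => simp
  | succ n ih =>
    rw [Finset.sum_range_succ, ← add_assoc, ← ih,
      inner_truncatedForce_add X x t (shellRadius_mono d n.le_succ)]
    rfl

lemma abs_inner_truncatedForce_sub_le (hd : 3 ≤ d) (X : Configuration d)
    (x t : EuclideanSpace ℝ (Fin d)) {k : ℕ} {R : ℝ} (h1 : shellRadius d k ≤ R)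
    (h2 : R ≤ shellRadius d (k + 1)) :
    |inner ℝ (X.truncatedForce x R) t - inner ℝ (X.truncatedForce x (shellRadius d k)) t| ≤
      ‖t‖ * ((shellRadius d k ^ (d - 1))⁻¹ * X.count ((fun z => x - z) ⁻¹' shell d k)) := by
  rw [inner_truncatedForce_add X x t h1, add_sub_cancel_left]
  have hpos := shellRadius_pos d k
  refine (abs_sumOver_le X (B := (fun z => x - z) ⁻¹' shell d k)
    (C := (shellRadius d k ^ (d - 1))⁻¹ * ‖t‖) (fun z hz => ⟨hz.1, hz.2.trans_le h2⟩)
    (isBounded_preimage_sub_left (isBounded_shell d k) x)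
    (by positivity) fun z hz => ?_).trans_eq (by ring)
  refine (abs_real_inner_le_norm _ _).trans ?_
  gcongr
  refine (norm_coulombKernel_le hd _).trans ?_
  gcongr
  exact hz.1

end Configuration

/-! ### Almost sure convergence and the law of the force. -/

namespace IsHomogeneousPoissonProcess

variable {d : ℕ} {Ω : Type*} [MeasurableSpace Ω] {P : Ω → Configuration d} {ρ : ℝ≥0}
  {μ : Measure Ω}

lemma ae_tendsto_count_shell [IsProbabilityMeasure μ] (hP : IsHomogeneousPoissonProcess P ρ μ)
    (hd : 3 ≤ d) (x : EuclideanSpace ℝ (Fin d)) :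
    ∀ᵐ ω ∂μ, Tendsto (fun k => (shellRadius d k ^ (d - 1))⁻¹ *
      ((P ω).count ((fun z => x - z) ⁻¹' shell d k) : ℝ)) atTop (𝓝 0) := by
  set V := volume (Metric.ball (0 : EuclideanSpace ℝ (Fin d)) 1)
  have hm : ∀ k, MeasurableSet ((fun z => x - z) ⁻¹' shell d k) := fun k => by
    have := measurableSet_shell d k
    measurability
  have hlaw := fun k => hP.hasLaw_count _ (hm k)
    (isBounded_preimage_sub_left (isBounded_shell d k) x)
  have hmc : ∀ k, Measurable fun ω => (P ω).count ((fun z => x - z) ⁻¹' shell d k) := fun k =>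
    (Configuration.measurable_count (hm k)
      (isBounded_preimage_sub_left (isBounded_shell d k) x)).comp hP.measurable
  set M := ∫⁻ n : ℕ, ENNReal.ofReal ((n : ℝ) ^ 2) ∂(poissonMeasure (ρ * V.toNNReal)) with hM
  have hMtop : M < ∞ := lintegral_sq_poissonMeasure_lt_top _
  have hmom : ∀ k, ∫⁻ ω, ENNReal.ofReal
      (((P ω).count ((fun z => x - z) ⁻¹' shell d k) : ℝ) ^ 2) ∂μ = M := fun k => by
    rw [hM, show V = _ from (volume_preimage_shell hd x k).symm, ← (hlaw k).map_eq,
      lintegral_map measurable_from_top (hmc k)]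
  have hmf : ∀ k, Measurable fun ω => ENNReal.ofReal
      (((P ω).count ((fun z => x - z) ⁻¹' shell d k) : ℝ) ^ 2) := fun k =>
    (measurable_from_top (f := fun n : ℕ => ENNReal.ofReal ((n : ℝ) ^ 2))).comp (hmc k)
  -- A series of squares with finite expectation converges almost surely, so its terms tend to zero;
  -- no independence is needed.
  have hsum : ∫⁻ ω, ∑' k, ENNReal.ofReal (((shellRadius d k ^ (d - 1))⁻¹) ^ 2) *
      ENNReal.ofReal (((P ω).count ((fun z => x - z) ⁻¹' shell d k) : ℝ) ^ 2) ∂μ ≠ ∞ := by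
    rw [lintegral_tsum fun k => ((hmf k).const_mul _).aemeasurable]
    simp only [lintegral_const_mul _ (hmf _), hmom]
    rw [ENNReal.tsum_mul_right]
    exact ENNReal.mul_ne_top (tsum_shellRadius_lt_top hd) hMtop.ne
  filter_upwards [ae_lt_top (Measurable.tsum fun k => (hmf k).const_mul _) hsum] with ω hω
  have h1 := ENNReal.tendsto_atTop_zero_of_tsum_ne_top hω.ne
  have h2 := (ENNReal.tendsto_toReal ENNReal.zero_ne_top).comp h1
  have h3 := (Real.continuous_sqrt.tendsto _).comp h2
  rw [ENNReal.toReal_zero, Real.sqrt_zero] at h3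
  refine h3.congr fun k => ?_
  have := shellRadius_pos d k
  simp only [Function.comp_apply]
  rw [← ENNReal.ofReal_mul (by positivity), ← mul_pow, ENNReal.toReal_ofReal (by positivity),
    Real.sqrt_sq (by positivity)]

lemma ae_tendsto_inner_truncatedForce_shellRadius [IsProbabilityMeasure μ]
    (hP : IsHomogeneousPoissonProcess P ρ μ) (hd : 3 ≤ d) (x t : EuclideanSpace ℝ (Fin d)) :
    ∀ᵐ ω ∂μ, ∃ l, Tendsto (fun n => inner ℝ ((P ω).truncatedForce x (shellRadius d n)) t) atTop
      (𝓝 l) := by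
  have hm : ∀ k, MeasurableSet ((fun z => x - z) ⁻¹' shell d k) := fun k => by
    have := measurableSet_shell d k
    measurability
  have hb := fun k => isBounded_preimage_sub_left (isBounded_shell d k) x
  have hg : Measurable fun z => inner ℝ (coulombKernel (x - z)) t := by fun_prop
  -- A partial sum over shells is one sum over an annulus, so the uniform second moment bound
  -- applies to it directly.
  have hunion : ∀ (ω) (n : ℕ), ∑ k ∈ Finset.range n, (P ω).sumOver ((fun z => x - z) ⁻¹' shell d k)
        (fun z => inner ℝ (coulombKernel (x - z)) t) =
      (P ω).sumOver ((fun z => x - z) ⁻¹' {y | shellRadius d 0 ≤ ‖y‖ ∧ ‖y‖ < shellRadius d n})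
        (fun z => inner ℝ (coulombKernel (x - z)) t) := fun ω n => by
    have h1 := (P ω).inner_truncatedForce_shellRadius x t n
    rw [(P ω).inner_truncatedForce_add x t (shellRadius_mono d n.zero_le)] at h1
    exact (add_left_cancel h1).symm
  have hone : ∀ k, shell d k ⊆ {y | 1 ≤ ‖y‖} := fun k y hy => (one_le_shellRadius d k).trans hy.1
  have := ae_exists_tendsto_sum_of_iIndepFun
    (W := fun k ω => (P ω).sumOver ((fun z => x - z) ⁻¹' shell d k)
        (fun z => inner ℝ (coulombKernel (x - z)) t))
    (fun k => hP.measurable_sumOver (hm k) (hb k) hg)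
    (hP.iIndepFun_sumOver _ hm hb (fun i j hij => (pairwise_disjoint_shell d hij).preimage _) hg)
    (fun k => hP.integrable_sumOver hd x t (measurableSet_shell d k) (isBounded_shell d k)
      (neg_mem_shell_iff k) (hone k))
    (fun k => hP.integral_sumOver_eq_zero x t (measurableSet_shell d k) (isBounded_shell d k)
      (neg_mem_shell_iff k))
    (C := (ρ * ∫ y in {y : EuclideanSpace ℝ (Fin d) | 1 ≤ ‖y‖},
        inner ℝ (coulombKernel y) t ^ 2).toNNReal) (fun n => by
      simp only [hunion]
      refine hP.lintegral_sumOver_sq_le hd x t ?_ ?_ (fun y => by simp)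
        fun y hy => (one_le_shellRadius d 0).trans hy.1
      · exact measurableSet_annulus _ _
      · exact (Metric.isBounded_ball (x := 0) (r := shellRadius d n)).subset
          fun y hy => by simpa using hy.2)
  filter_upwards [this] with ω ⟨l, hl⟩
  refine ⟨inner ℝ ((P ω).truncatedForce x (shellRadius d 0)) t + l, ?_⟩
  exact (hl.const_add _).congr fun n => ((P ω).inner_truncatedForce_shellRadius x t n).symm

lemma ae_tendsto_inner_truncatedForce [IsProbabilityMeasure μ]
    (hP : IsHomogeneousPoissonProcess P ρ μ) (hd : 3 ≤ d) (x t : EuclideanSpace ℝ (Fin d)) :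
    ∀ᵐ ω ∂μ, ∃ l, Tendsto (fun R => inner ℝ ((P ω).truncatedForce x R) t) atTop (𝓝 l) := by
  filter_upwards [hP.ae_tendsto_inner_truncatedForce_shellRadius hd x t,
    hP.ae_tendsto_count_shell hd x] with ω ⟨l, hl⟩ hc
  refine ⟨l, ?_⟩
  -- Shell `k` starts at radius `(k+1)^{1/d}`, hence the `- 1`; the truncated subtraction is exact
  -- for `R ≥ 1`.
  let k : ℝ → ℕ := fun R => ⌊R ^ d⌋₊ - 1
  have hk : Tendsto k atTop atTop :=
    (tendsto_sub_atTop_nat 1).comp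
      (tendsto_nat_floor_atTop.comp (tendsto_pow_atTop (by omega)))
  have hk1 : ∀ R : ℝ, 1 ≤ R → shellRadius d (k R) ≤ R ∧ R ≤ shellRadius d (k R + 1) := by
    intro R hR
    have hR1 : 1 ≤ R ^ d := one_le_pow₀ hR
    have hf : 1 ≤ ⌊R ^ d⌋₊ := Nat.one_le_floor_iff _ |>.2 hR1
    have hkR : ((k R : ℕ) : ℝ) + 1 = ⌊R ^ d⌋₊ := by
      simp only [k]
      rw [Nat.cast_sub hf]
      simp
    constructor
    · rw [← pow_le_pow_iff_left₀ (shellRadius_pos _ _).le (by linarith) (by omega : d ≠ 0),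
        shellRadius_pow hd, hkR]
      exact Nat.floor_le (by linarith)
    · rw [← pow_le_pow_iff_left₀ (by linarith) (shellRadius_pos _ _).le (by omega : d ≠ 0),
        shellRadius_pow hd]
      push_cast
      rw [hkR]
      exact (Nat.lt_floor_add_one _).le
  have h0 : Tendsto (fun R => inner ℝ ((P ω).truncatedForce x R) t -
      inner ℝ ((P ω).truncatedForce x (shellRadius d (k R))) t) atTop (𝓝 0) := by
    have h1 := (hc.comp hk).const_mul ‖t‖
    rw [mul_zero] at h1
    refine squeeze_zero_norm' ?_ h1
    filter_upwards [eventually_ge_atTop 1] with R hR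
    exact (P ω).abs_inner_truncatedForce_sub_le hd x t (hk1 R hR).1 (hk1 R hR).2
  have h2 := h0.add (hl.comp hk)
  simpa [Function.comp_def] using h2

theorem ae_forceConverges [IsProbabilityMeasure μ] (hP : IsHomogeneousPoissonProcess P ρ μ)
    (hd : 3 ≤ d) (x : EuclideanSpace ℝ (Fin d)) : ∀ᵐ ω ∂μ, (P ω).ForceConverges x := by
  -- The exceptional null set depends on the direction, so only the finitely many basis vectors are
  -- used.
  filter_upwards [ae_all_iff.2 fun i : Fin d =>
    hP.ae_tendsto_inner_truncatedForce hd x (EuclideanSpace.single i 1)] with ω hω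
  choose l hl using hω
  refine ⟨WithLp.toLp 2 l, ?_⟩
  have h1 : Tendsto (fun R => (fun i => (P ω).truncatedForce x R i)) atTop (𝓝 l) :=
    tendsto_pi_nhds.2 fun i => by simpa [EuclideanSpace.inner_single_right] using hl i
  exact ((PiLp.continuous_toLp 2 _).tendsto l).comp h1

lemma ae_tendsto_truncatedForce [IsProbabilityMeasure μ] (hP : IsHomogeneousPoissonProcess P ρ μ)
    (hd : 3 ≤ d) (x : EuclideanSpace ℝ (Fin d)) :
    ∀ᵐ ω ∂μ, Tendsto (fun n : ℕ => (P ω).truncatedForce x n) atTop (𝓝 ((P ω).force x)) := by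
  filter_upwards [hP.ae_forceConverges hd x] with ω h
  exact (tendsto_nhds_limUnder h).comp tendsto_natCast_atTop_atTop

lemma measurable_inner_truncatedForce (hP : IsHomogeneousPoissonProcess P ρ μ)
    (x t : EuclideanSpace ℝ (Fin d)) (R : ℝ) :
    Measurable fun ω => inner ℝ ((P ω).truncatedForce x R) t := by
  simp only [Configuration.inner_truncatedForce]
  exact hP.measurable_sumOver measurableSet_ball Metric.isBounded_ball (by fun_prop)

lemma measurable_truncatedForce (hP : IsHomogeneousPoissonProcess P ρ μ)
    (x : EuclideanSpace ℝ (Fin d)) (R : ℝ) : Measurable fun ω => (P ω).truncatedForce x R := by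
  have h : Measurable fun ω i => (P ω).truncatedForce x R i := measurable_pi_lambda _ fun i => by
    simpa [EuclideanSpace.inner_single_right] using
      hP.measurable_inner_truncatedForce x (EuclideanSpace.single i 1) R
  exact (PiLp.continuous_toLp 2 _).measurable.comp h

lemma aemeasurable_force [IsProbabilityMeasure μ] (hP : IsHomogeneousPoissonProcess P ρ μ)
    (hd : 3 ≤ d) (x : EuclideanSpace ℝ (Fin d)) : AEMeasurable (fun ω => (P ω).force x) μ :=
  aemeasurable_of_tendsto_metrizable_ae atTop
    (fun n : ℕ => (hP.measurable_truncatedForce x n).aemeasurable)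
    (hP.ae_tendsto_truncatedForce hd x)

/-- The characteristic function of the Coulomb force of a homogeneous Poisson process. -/
theorem charFun_force [IsProbabilityMeasure μ] (hP : IsHomogeneousPoissonProcess P ρ μ)
    (hd : 3 ≤ d) (x t : EuclideanSpace ℝ (Fin d)) :
    charFun (μ.map fun ω => (P ω).force x) t =
      ((Real.exp (-(ρ * coulombExponent t)) : ℝ) : ℂ) := by
  rw [charFun_apply, integral_map (hP.aemeasurable_force hd x)
    (by fun_prop : Measurable _).aestronglyMeasurable]
  have hlim : Tendsto (fun n : ℕ => ∫ ω, Complex.exp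
      ((inner ℝ ((P ω).truncatedForce x n) t : ℝ) * Complex.I) ∂μ) atTop
      (𝓝 (∫ ω, Complex.exp ((inner ℝ ((P ω).force x) t : ℝ) * Complex.I) ∂μ)) := by
    refine tendsto_integral_of_dominated_convergence (fun _ => 1) (fun n => ?_)
      (integrable_const _) (fun n => ?_) ?_
    · have := hP.measurable_inner_truncatedForce x t n
      exact (by fun_prop : Measurable _).aestronglyMeasurable
    · exact ae_of_all _ fun ω => by rw [Complex.norm_exp_ofReal_mul_I]
    · filter_upwards [hP.ae_tendsto_truncatedForce hd x] with ω hω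
      exact ((Complex.continuous_ofReal.tendsto _).comp (hω.inner tendsto_const_nhds)
        |>.mul_const _).cexp
  -- The same integrals are now computed exactly on balls, whose exponents converge because the
  -- balls exhaust the space.
  refine tendsto_nhds_unique hlim ?_
  have hchar : ∀ n : ℕ, ∫ ω, Complex.exp
      ((inner ℝ ((P ω).truncatedForce x n) t : ℝ) * Complex.I) ∂μ =
      ((Real.exp (-(ρ * ∫ y in Metric.ball 0 (n : ℝ),
        (1 - Real.cos (inner ℝ (coulombKernel y) t)))) : ℝ) : ℂ) := by
    intro n
    have hball : Metric.ball x (n : ℝ) = (fun z => x - z) ⁻¹' Metric.ball 0 (n : ℝ) := by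
      ext z
      simp [dist_eq_norm, norm_sub_rev]
    have h1 := hP.charFun_sumOver_symmetric x t (S := Metric.ball 0 (n : ℝ)) measurableSet_ball
      Metric.isBounded_ball (fun y => by simp) 1
    rw [← hball, charFun_apply_real, integral_map (hP.measurable_sumOver measurableSet_ball
      Metric.isBounded_ball (by fun_prop)).aemeasurable
      (by fun_prop : Measurable _).aestronglyMeasurable] at h1
    simpa only [Configuration.inner_truncatedForce, Complex.ofReal_one, one_mul] using h1
  simp only [hchar]
  have hball : AECover (volume : Measure (EuclideanSpace ℝ (Fin d))) atTop
      fun n : ℕ => Metric.ball 0 (n : ℝ) :=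
    aecover_ball tendsto_natCast_atTop_atTop
  have h2 := hball.integral_tendsto_of_countably_generated
    (integrable_one_sub_cos_coulombKernel hd t)
  exact (Complex.continuous_ofReal.tendsto _).comp
    ((Real.continuous_exp.tendsto _).comp (h2.const_mul _).neg)

end IsHomogeneousPoissonProcess

/-! ### Stability and moments from a homogeneous exponent. -/

section StableCharFun

variable {E : Type*} [NormedAddCommGroup E] [InnerProductSpace ℝ E]
  [MeasurableSpace E] [BorelSpace E] {m : Measure E} [IsProbabilityMeasure m] {α : ℝ} {φ : E → ℝ}

/-- The truncation inequality bounds the tail by `r/2` times the integral of `1 - charFun` over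
`[-2/r, 2/r]`, where the integrand is at most `φ(st) ≤ (2/r)^α φ(t)`. -/
lemma measureReal_abs_inner_gt_le_of_charFun (hα : 0 < α)
    (hm : ∀ t, charFun m t = ((Real.exp (-φ t) : ℝ) : ℂ)) (hφ0 : ∀ t, 0 ≤ φ t)
    (hφneg : ∀ t, φ (-t) = φ t) (hφ : ∀ s : ℝ, 0 < s → ∀ t, φ (s • t) = s ^ α * φ t) (t : E)
    {r : ℝ} (hr : 0 < r) :
    m.real {y | r < |inner ℝ t y|} ≤ 2 * 2 ^ α * φ t * r ^ (-α) := by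
  have hzero : φ 0 = 0 := by
    have h := hm 0
    rw [charFun_zero, probReal_univ] at h
    have h' : Real.exp (-φ 0) = 1 := by exact_mod_cast h.symm
    rw [Real.exp_eq_one_iff] at h'
    linarith
  have hbound : ∀ s : ℝ, |s| ≤ 2 * r⁻¹ → ‖1 - charFun m (s • t)‖ ≤ (2 * r⁻¹) ^ α * φ t := by
    intro s hs
    have habs : φ (s • t) = |s| ^ α * φ t := by
      rcases lt_trichotomy s 0 with h | rfl | h
      · rw [abs_of_neg h, ← hφ _ (neg_pos.2 h), neg_smul, hφneg]
      · rw [zero_smul, hzero, abs_zero, Real.zero_rpow hα.ne', zero_mul]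
      · rw [abs_of_pos h, hφ _ h]
    have h1 : ‖1 - charFun m (s • t)‖ ≤ φ (s • t) := by
      rw [hm, ← Complex.ofReal_one, ← Complex.ofReal_sub, Complex.norm_real,
        Real.norm_of_nonneg (sub_nonneg.2 (Real.exp_le_one_iff.2 (neg_nonpos.2 (hφ0 _))))]
      linarith [Real.one_sub_le_exp_neg (φ (s • t))]
    rw [habs] at h1
    refine h1.trans ?_
    have := hφ0 t
    gcongr
  refine (measureReal_abs_inner_gt_le_integral_charFun hr).trans ?_
  have h2 := intervalIntegral.norm_integral_le_of_norm_le_const (a := -2 * r⁻¹) (b := 2 * r⁻¹)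
    (f := fun s => 1 - charFun m (s • t)) (C := (2 * r⁻¹) ^ α * φ t) (fun s hs => hbound s (by
      rw [Set.uIoc_of_le (by nlinarith [inv_pos.2 hr])] at hs
      exact abs_le.2 ⟨by linarith [hs.1], hs.2⟩))
  calc 2⁻¹ * r * ‖∫ s in -2 * r⁻¹..2 * r⁻¹, 1 - charFun m (s • t)‖
      ≤ 2⁻¹ * r * ((2 * r⁻¹) ^ α * φ t * |2 * r⁻¹ - -2 * r⁻¹|) := by gcongr
    _ = 2 * 2 ^ α * φ t * r ^ (-α) := by
      rw [Real.mul_rpow (by positivity) (by positivity), Real.inv_rpow hr.le,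
        ← Real.rpow_neg hr.le, show 2 * r⁻¹ - -2 * r⁻¹ = 4 * r⁻¹ by ring, abs_of_pos (by positivity)]
      field_simp
      ring

variable [SecondCountableTopology E]

/-- By independence the exponents add up to `(a^α + b^α) φ(t)`, which homogeneity identifies with
the exponent of the rescaled vector. -/
lemma map_smul_add_smul_eq_of_charFun [CompleteSpace E] (hα : 0 < α)
    (hm : ∀ t, charFun m t = ((Real.exp (-φ t) : ℝ) : ℂ))
    (hφ : ∀ s : ℝ, 0 < s → ∀ t, φ (s • t) = s ^ α * φ t) {a b : ℝ} (ha : 0 < a) (hb : 0 < b) :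
    (m.prod m).map (fun y => a • y.1 + b • y.2) =
      m.map (fun y => ((a ^ α + b ^ α) ^ (1 / α)) • y) := by
  have h1 : (m.prod m).map (fun y => a • y.1 + b • y.2) =
      ((m.map (a • ·)).prod (m.map (b • ·))).map (fun p => p.1 + p.2) := by
    rw [Measure.map_prod_map _ _ (by fun_prop) (by fun_prop),
      Measure.map_map (by fun_prop) (by fun_prop)]
    rfl
  have := Measure.isProbabilityMeasure_map (μ := m) (f := (a • ·)) (by fun_prop)
  have := Measure.isProbabilityMeasure_map (μ := m) (f := (b • ·)) (by fun_prop)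
  have hab : 0 < a ^ α + b ^ α := by positivity
  refine Measure.ext_of_charFun (funext fun t => ?_)
  rw [h1, charFun_map_add_prod_eq_mul, Pi.mul_apply, charFun_map_smul, charFun_map_smul,
    charFun_map_smul, hm, hm, hm, hφ a ha, hφ b hb, hφ _ (by positivity), ← Complex.ofReal_mul,
    ← Real.exp_add, ← Real.rpow_mul hab.le, one_div_mul_cancel hα.ne', Real.rpow_one]
  congr 2
  ring

lemma lintegral_abs_inner_rpow_lt_top_of_charFun (hα : 0 < α)
    (hm : ∀ t, charFun m t = ((Real.exp (-φ t) : ℝ) : ℂ)) (hφ0 : ∀ t, 0 ≤ φ t)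
    (hφneg : ∀ t, φ (-t) = φ t) (hφ : ∀ s : ℝ, 0 < s → ∀ t, φ (s • t) = s ^ α * φ t) (t : E)
    {ν : ℝ} (hν1 : 1 ≤ ν) (hν : ν < α) :
    ∫⁻ y, ENNReal.ofReal (|inner ℝ t y| ^ ν) ∂m < ∞ := by
  rw [lintegral_rpow_eq_lintegral_meas_lt_mul m (ae_of_all _ fun _ => abs_nonneg _)
    (by fun_prop) (by linarith)]
  refine ENNReal.mul_lt_top ENNReal.ofReal_lt_top ?_
  -- Below `1` the probability is bounded by `1`; above `1` the tail bound leaves `r^{ν-1-α}`,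
  -- integrable since `ν < α`.
  rw [← Set.Ioc_union_Ioi_eq_Ioi zero_le_one]
  refine (lintegral_union_le _ _ _).trans_lt (ENNReal.add_lt_top.2 ⟨?_, ?_⟩)
  · calc ∫⁻ r in Set.Ioc (0 : ℝ) 1, m {y | r < |inner ℝ t y|} * ENNReal.ofReal (r ^ (ν - 1))
        ≤ ∫⁻ _ in Set.Ioc (0 : ℝ) 1, 1 := by
          refine setLIntegral_mono' measurableSet_Ioc fun r hr => ?_
          refine mul_le_one' prob_le_one ?_
          rw [← ENNReal.ofReal_one]
          exact ENNReal.ofReal_le_ofReal (Real.rpow_le_one hr.1.le hr.2 (by linarith))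
      _ < ∞ := by simp
  · have hi : IntegrableOn (fun r : ℝ => 2 * 2 ^ α * φ t * r ^ (ν - 1 - α)) (Set.Ioi 1) :=
      (integrableOn_Ioi_rpow_of_lt (by linarith) one_pos).const_mul _
    refine lt_of_le_of_lt ?_ hi.lintegral_lt_top
    refine setLIntegral_mono' measurableSet_Ioi fun r (hr : 1 < r) => ?_
    have hr0 : 0 < r := by linarith
    rw [← ofReal_measureReal, ← ENNReal.ofReal_mul measureReal_nonneg]
    refine ENNReal.ofReal_le_ofReal ?_
    calc m.real {y | r < |inner ℝ t y|} * r ^ (ν - 1)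
        ≤ 2 * 2 ^ α * φ t * r ^ (-α) * r ^ (ν - 1) := by
          gcongr
          exact measureReal_abs_inner_gt_le_of_charFun hα hm hφ0 hφneg hφ t hr0
      _ = 2 * 2 ^ α * φ t * r ^ (ν - 1 - α) := by
          rw [mul_assoc, ← Real.rpow_add hr0]
          ring_nf

lemma lintegral_abs_inner_rpow_eq_top_of_charFun (hα : 0 < α) (hα2 : α < 2)
    (hm : ∀ t, charFun m t = ((Real.exp (-φ t) : ℝ) : ℂ))
    (hφ : ∀ s : ℝ, 0 < s → ∀ t, φ (s • t) = s ^ α * φ t) {t : E} (ht : 0 < φ t) :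
    ∫⁻ y, ENNReal.ofReal (|inner ℝ y t| ^ α) ∂m = ∞ := by
  by_contra hfin
  have hint : Integrable (fun y => |inner ℝ y t| ^ α) m := by
    refine ⟨(by fun_prop : Measurable _).aestronglyMeasurable, ?_⟩
    rw [hasFiniteIntegral_iff_ofReal (ae_of_all _ fun y => by positivity)]
    exact lt_top_iff_ne_top.2 hfin
  let s : ℕ → ℝ := fun n => 1 / ((n : ℝ) + 1)
  have hs0 : ∀ n, 0 < s n := fun n => by positivity
  have hs1 : ∀ n, s n ≤ 1 := fun n => by
    simp only [s]
    rw [div_le_one (by positivity)]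
    linarith [(Nat.cast_nonneg n : (0 : ℝ) ≤ n)]
  have hs : Tendsto s atTop (𝓝 0) := tendsto_one_div_add_atTop_nhds_zero_nat
  -- After division by `s n ^ α` this gives a dominating function independent of `n`, integrable
  -- under the assumption to be refuted.
  have hle : ∀ u : ℝ, 1 - Real.cos u ≤ 2 * |u| ^ α := by
    intro u
    rcases le_total |u| 1 with h | h
    · have h1 : |u| ^ 2 ≤ |u| ^ α := by
        rw [← Real.rpow_natCast]
        rcases (abs_nonneg u).eq_or_lt with h0 | h0
        · rw [← h0, Real.zero_rpow hα.ne', Real.zero_rpow (by norm_num)]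
        · exact Real.rpow_le_rpow_of_exponent_ge h0 h (by norm_num; exact hα2.le)
      rw [sq_abs] at h1
      nlinarith [Real.one_sub_cos_le_sq_div_two u, sq_nonneg u]
    · have := Real.one_le_rpow h hα.le
      linarith [Real.neg_one_le_cos u]
  have hlim : Tendsto (fun n => ∫ y, (1 - Real.cos (inner ℝ y (s n • t))) / s n ^ α ∂m) atTop
      (𝓝 (∫ _, 0 ∂m)) := by
    refine tendsto_integral_of_dominated_convergence (fun y => 2 * |inner ℝ y t| ^ α)
      (fun n => (by fun_prop : Measurable _).aestronglyMeasurable) (hint.const_mul 2)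
      (fun n => ae_of_all _ fun y => ?_) (ae_of_all _ fun y => ?_)
    · have hp : 0 < s n ^ α := Real.rpow_pos_of_pos (hs0 n) _
      rw [Real.norm_of_nonneg (div_nonneg (sub_nonneg.2 (Real.cos_le_one _)) hp.le),
        div_le_iff₀ hp]
      refine (hle _).trans_eq ?_
      rw [real_inner_smul_right, abs_mul, abs_of_pos (hs0 n),
        Real.mul_rpow (hs0 n).le (abs_nonneg _)]
      ring
    · have h0 : Tendsto (fun n => s n ^ (2 - α) * (inner ℝ y t ^ 2 / 2)) atTop (𝓝 0) := by
        have h1 := (hs.rpow_const (p := 2 - α) (Or.inr (by linarith))).mul_const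
          (inner ℝ y t ^ 2 / 2)
        rwa [Real.zero_rpow (by linarith), zero_mul] at h1
      refine squeeze_zero (fun n => div_nonneg (sub_nonneg.2 (Real.cos_le_one _))
        (Real.rpow_pos_of_pos (hs0 n) _).le) (fun n => ?_) h0
      rw [div_le_iff₀ (Real.rpow_pos_of_pos (hs0 n) _)]
      refine (Real.one_sub_cos_le_sq_div_two _).trans_eq ?_
      rw [real_inner_smul_right, mul_right_comm, ← Real.rpow_add (hs0 n), sub_add_cancel,
        Real.rpow_two]
      ring
  -- From `e^{-v} ≤ 1/(1+v)` with `v = s^α φ(t)` and `s ≤ 1`: a positive lower bound uniform in `n`,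
  -- incompatible with the limit `0`.
  have hge : ∀ n, φ t / (1 + φ t) ≤
      ∫ y, (1 - Real.cos (inner ℝ y (s n • t))) / s n ^ α ∂m := by
    intro n
    have hp : 0 < s n ^ α := Real.rpow_pos_of_pos (hs0 n) _
    have hp1 : s n ^ α ≤ 1 := Real.rpow_le_one (hs0 n).le (hs1 n) hα.le
    rw [integral_div, integral_one_sub_cos_inner, hm, Complex.ofReal_re, hφ _ (hs0 n),
      le_div_iff₀ hp, Real.exp_neg]
    have h1 : 1 + s n ^ α * φ t ≤ Real.exp (s n ^ α * φ t) := by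
      linarith [Real.add_one_le_exp (s n ^ α * φ t)]
    have h2 : (Real.exp (s n ^ α * φ t))⁻¹ ≤ (1 + s n ^ α * φ t)⁻¹ := by
      gcongr
    have h3 : 1 - (1 + s n ^ α * φ t)⁻¹ = s n ^ α * φ t / (1 + s n ^ α * φ t) := by
      field_simp
      ring
    have h4 : φ t / (1 + φ t) * s n ^ α ≤ s n ^ α * φ t / (1 + s n ^ α * φ t) := by
      rw [div_mul_eq_mul_div, mul_comm (φ t)]
      gcongr
      nlinarith
    linarith
  have h := ge_of_tendsto' hlim hge
  rw [integral_zero] at h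
  exact absurd h (not_le.2 (by positivity))

end StableCharFun

/-! ### Moments of a vector through its linear functionals. -/

section Moments

variable {d : ℕ} {m : Measure (EuclideanSpace ℝ (Fin d))}

lemma lintegral_norm_rpow_lt_top_of_inner {ν : ℝ} (hν : 1 ≤ ν)
    (h : ∀ t : EuclideanSpace ℝ (Fin d), ∫⁻ y, ENNReal.ofReal (|inner ℝ t y| ^ ν) ∂m < ∞) :
    ∫⁻ y, ENNReal.ofReal (‖y‖ ^ ν) ∂m < ∞ := by
  have hν0 : 0 < ν := by linarith
  have hp0 : ENNReal.ofReal ν ≠ 0 := by simpa using hν0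
  have key : ∀ {F : Type} [NormedAddCommGroup F] (f : EuclideanSpace ℝ (Fin d) → F),
      eLpNorm f (ENNReal.ofReal ν) m < ∞ ↔ ∫⁻ y, ENNReal.ofReal (‖f y‖ ^ ν) ∂m < ∞ := by
    intro F _ f
    rw [eLpNorm_lt_top_iff_lintegral_rpow_enorm_lt_top hp0 ENNReal.ofReal_ne_top,
      ENNReal.toReal_ofReal hν0.le]
    refine iff_of_eq (congrArg (· < ∞) (lintegral_congr fun y => ?_))
    rw [← ofReal_norm, ENNReal.ofReal_rpow_of_nonneg (norm_nonneg _) hν0.le]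
  refine (key fun y => y).1 (MemLp.of_eval_piLp fun i => ⟨by fun_prop, (key fun y => y i).2 ?_⟩).2
  simpa [EuclideanSpace.inner_single_left] using h (EuclideanSpace.single i 1)

lemma lintegral_norm_rpow_lt_top_of_le [IsProbabilityMeasure m] {p q : ℝ} (hp : 0 ≤ p) (hpq : p ≤ q)
    (h : ∫⁻ y, ENNReal.ofReal (‖y‖ ^ q) ∂m < ∞) : ∫⁻ y, ENNReal.ofReal (‖y‖ ^ p) ∂m < ∞ := by
  refine lt_of_le_of_lt (b := ∫⁻ y, (1 + ENNReal.ofReal (‖y‖ ^ q)) ∂m) (lintegral_mono fun y => ?_) ?_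
  · rw [← ENNReal.ofReal_one, ← ENNReal.ofReal_add zero_le_one (by positivity)]
    refine ENNReal.ofReal_le_ofReal ?_
    rcases le_total ‖y‖ 1 with h1 | h1
    · have := Real.rpow_le_one (norm_nonneg y) h1 hp
      have : 0 ≤ ‖y‖ ^ q := by positivity
      linarith
    · have := Real.rpow_le_rpow_of_exponent_le h1 hpq
      linarith
  · rw [lintegral_add_left measurable_const, lintegral_const, measure_univ]
    exact ENNReal.add_lt_top.2 ⟨by simp, h⟩

lemma lintegral_norm_rpow_eq_top_of_inner {ν : ℝ} (hν : 0 ≤ ν) {t : EuclideanSpace ℝ (Fin d)}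
    (ht : ‖t‖ ≤ 1) (h : ∫⁻ y, ENNReal.ofReal (|inner ℝ y t| ^ ν) ∂m = ∞) :
    ∫⁻ y, ENNReal.ofReal (‖y‖ ^ ν) ∂m = ∞ := by
  refine eq_top_mono (lintegral_mono fun y => ENNReal.ofReal_le_ofReal ?_) h
  gcongr
  exact (abs_real_inner_le_norm y t).trans (mul_le_of_le_one_right (norm_nonneg _) ht)

end Moments

/-! ### The main theorem. -/

theorem proposition3 {d : ℕ} (hd : 3 ≤ d) {Ω : Type*} [MeasurableSpace Ω] (μ : Measure Ω)
    [IsProbabilityMeasure μ] (ρ : ℝ≥0) (hρ : 0 < ρ) (P : Ω → Configuration d)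
    (hP : IsHomogeneousPoissonProcess P ρ μ) (x : EuclideanSpace ℝ (Fin d)) :
    (∀ᵐ ω ∂μ, (P ω).ForceConverges x) ∧
    AEMeasurable (fun ω => (P ω).force x) μ ∧
    IsSymmetricStableDistribution ((d : ℝ) / ((d : ℝ) - 1))
      (μ.map (fun ω => (P ω).force x)) ∧
    (Integrable (fun ω => (P ω).force x) μ ∧ ∫ ω, (P ω).force x ∂μ = 0) ∧
    (∀ ν : ℝ, 0 ≤ ν →
      (∫⁻ ω, ENNReal.ofReal (‖(P ω).force x‖ ^ ν) ∂μ < ∞ ↔ ν < (d : ℝ) / ((d : ℝ) - 1))) := by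
  have hd' : (3 : ℝ) ≤ d := by exact_mod_cast hd
  set α : ℝ := (d : ℝ) / ((d : ℝ) - 1) with hα
  have hα1 : 1 < α := by
    rw [hα, one_lt_div (by linarith)]
    linarith
  have hα2 : α < 2 := by
    rw [hα, div_lt_iff₀ (by linarith)]
    linarith
  have hα0 : 0 < α := by linarith
  have hF := hP.aemeasurable_force hd x
  set m := μ.map (fun ω => (P ω).force x) with hm
  have hprob : IsProbabilityMeasure m := Measure.isProbabilityMeasure_map hF
  let φ : EuclideanSpace ℝ (Fin d) → ℝ := fun t => ρ * coulombExponent t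
  have hchar : ∀ t, charFun m t = ((Real.exp (-φ t) : ℝ) : ℂ) := hP.charFun_force hd x
  have hφ0 : ∀ t, 0 ≤ φ t := fun t => mul_nonneg ρ.coe_nonneg (coulombExponent_nonneg t)
  have hφneg : ∀ t, φ (-t) = φ t := fun t => by simp only [φ, coulombExponent_neg]
  have hφ : ∀ s : ℝ, 0 < s → ∀ t, φ (s • t) = s ^ α * φ t := fun s hs t => by
    simp only [φ, coulombExponent_smul hd hs t]
    ring
  have hsymm : m.map (fun y => -y) = m :=
    map_neg_eq_of_charFun_neg fun t => by rw [hchar, hchar, hφneg]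
  have hmom : ∀ ν : ℝ, 0 ≤ ν → (∫⁻ y, ENNReal.ofReal (‖y‖ ^ ν) ∂m < ∞ ↔ ν < α) := by
    intro ν hν
    refine ⟨fun h => ?_, fun h => ?_⟩
    · by_contra hle
      let t : EuclideanSpace ℝ (Fin d) := EuclideanSpace.single ⟨0, by omega⟩ 1
      have ht1 : ‖t‖ = 1 := by simp [t]
      have ht : t ≠ 0 := norm_ne_zero_iff.1 (by rw [ht1]; exact one_ne_zero)
      have htop := lintegral_norm_rpow_eq_top_of_inner hα0.le ht1.le
        (lintegral_abs_inner_rpow_eq_top_of_charFun hα0 hα2 hchar hφ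
          (mul_pos (NNReal.coe_pos.2 hρ) (coulombExponent_pos hd ht)))
      exact (lintegral_norm_rpow_lt_top_of_le hα0.le (not_lt.1 hle) h).ne htop
    -- The exponent is raised to `max ν 1`, still below `α` since `α > 1`, because the moment bounds
    -- are stated for exponents at least `1`.
    · refine lintegral_norm_rpow_lt_top_of_le hν (le_max_left ν 1)
        (lintegral_norm_rpow_lt_top_of_inner (le_max_right ν 1) fun t => ?_)
      exact lintegral_abs_inner_rpow_lt_top_of_charFun hα0 hchar hφ0 hφneg hφ t (le_max_right ν 1)
        (max_lt h hα1)
  have hmomF : ∀ ν : ℝ, ∫⁻ ω, ENNReal.ofReal (‖(P ω).force x‖ ^ ν) ∂μ =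
      ∫⁻ y, ENNReal.ofReal (‖y‖ ^ ν) ∂m := fun ν => by
    rw [hm, lintegral_map' (by fun_prop) hF]
  refine ⟨hP.ae_forceConverges hd x, hF, ?_, ⟨?_, ?_⟩, fun ν hν => ?_⟩
  · refine ⟨⟨hprob, hα0, hα2.le, fun v hv => ?_, fun a b ha hb => ⟨0, ?_⟩⟩, hsymm⟩
    -- A point mass would have a finite moment of order `α`.
    · refine lt_irrefl α ((hmom α hα0.le).1 ?_)
      rw [hv, lintegral_dirac]
      exact ENNReal.ofReal_lt_top
    · simp only [add_zero]
      exact map_smul_add_smul_eq_of_charFun hα0 hchar hφ ha hb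
  · refine ⟨hF.aestronglyMeasurable, ?_⟩
    rw [hasFiniteIntegral_iff_norm]
    have h := (hmom 1 zero_le_one).2 hα1
    rw [← hmomF] at h
    simpa only [Real.rpow_one] using h
  · have h := integral_eq_zero_of_map_neg hsymm
    rwa [hm, integral_map hF (by fun_prop)] at h
  · rw [hmomF]
    exact hmom ν hν
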